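/- Let $K$ be a non-archimedean local field with separable closure $K^s$ and residue field of $q$ elements, and let $E$ be a field of characteristic $0$ (for instance $E=\mathbb{C}$). A Weil–Deligne representation $\rho=(\rho_{\rm Weil},N)$ of $K$ over $E$ consists of a representation $\rho_{\rm Weil}$, with open kernel, of the Weil group $W_K$ on a finite-dimensional $E$-vector space $V$, and a nilpotent endomorphism $N$ of $V$ with $\rho_{\rm Weil}(w)\,N\,\rho_{\rm Weil}(w)^{-1}=q^{d}N$ whenever $w\in W_K$ acts on the residue field of $K^s$ as $x\mapsto x^{q^d}$, $d\in\mathbb{Z}$. It is Frobenius-semisimple if arithmetic Frobenius elements of $K$ act semisimply; then $\rho\cong\bigoplus_{n\ge1}\rho_n\otimes \mathrm{Sp}_n$, where the $\rho_n$ are semisimple Weil representations and $\mathrm{Sp}_n$ is the $n$-dimensional special representation, normalised so that $W_K$ acts trivially on its line $\ker N$; thus $\rho_n\cong(\ker N\cap \operatorname{im}N^{n-1})/(\ker N\cap \operatorname{im}N^{n})$. It is weight-monodromy compatible if for every $n\ge 1$ all eigenvalues of arithmetic Frobenius elements of $K$ on $\rho_n$ are Weil numbers of absolute value $q^{(n-1)/2}$,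 that is, algebraic over $\mathbb{Q}$ with all complex conjugates of absolute value $q^{(n-1)/2}$. Write $\rho^{N=0}$ for the Weil representation on $\ker N$. Frobenius-semisimple weight-monodromy compatible Weil–Deligne representations of $K$ over $E$ are uniquely determined, up to isomorphism, by the traces $\operatorname{tr}\rho^{N=0}(\mathrm{Frob}_L)$, where $L$ ranges over the finite separable extensions of $K$ over which $\rho_{\rm Weil}$ is unramified. That is: if $\rho$ and $\rho'$ are two such representations and $\operatorname{tr}\rho^{N=0}(\mathrm{Frob}_L)=\operatorname{tr}\rho'^{N=0}(\mathrm{Frob}_L)$ for every finite extension $L$ of $K$ inside $K^s$ over which both $\rho_{\rm Weil}$ and $\rho'_{\rm Weil}$ are unramified, where $\mathrm{Frob}_L$ is an arithmetic Frobenius element of $L$, then $\rho\cong\rho'$. -/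

import Mathlib

open ValuativeRel

/-! ### The Galois group of a local field, its inertia group and Frobenius elements -/

section Galois

variable (K : Type*) [Field K] [ValuativeRel K]

/-- The absolute Galois group `Gal(K^s/K)`, with its Krull topology. -/
abbrev AbsGal : Type _ := Gal(SeparableClosure K/K)

/-- The ring of integers of an algebraic extension `M` of `K`: the integral closure of `𝒪[K]`. -/
noncomputable abbrev intRing (M : Type*) [Field M] [Algebra K M] : Subalgebra 𝒪[K] M :=
  integralClosure 𝒪[K] M

/-- The maximal ideal of the ring of integers of an algebraic extension `M` of `K`.  When `K` is a
local field this ring is local, so that its Jacobson radical is its maximal ideal. -/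
noncomputable abbrev maxIdeal (M : Type*) [Field M] [Algebra K M] : Ideal (intRing K M) :=
  Ring.jacobson (intRing K M)

/-- The number of elements of the residue field of a finite extension `M` of `K`. -/
noncomputable def residueCard (M : Type*) [Field M] [Algebra K M] : ℕ :=
  Nat.card (intRing K M ⧸ maxIdeal K M)

/-- The number `q` of elements of the residue field of `K`. -/
noncomputable abbrev resCard : ℕ := Nat.card 𝓀[K]

variable {K}

/-- `σ` acts on the residue field of `K^s` as the map `x ↦ x ^ r`. -/
def ActsAsPow (σ : AbsGal K) (r : ℕ) : Prop :=
  ∀ x : intRing K (SeparableClosure K), σ • x - x ^ r ∈ maxIdeal K (SeparableClosure K)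

/-- `σ` is an arithmetic Frobenius element of `K`. -/
def IsFrob (σ : AbsGal K) : Prop := ActsAsPow σ (resCard K)

/-- `σ` is an arithmetic Frobenius element of the intermediate field `L` of `K^s/K`: it fixes `L`
and acts on the residue field of `K^s` as `x ↦ x ^ q_L`, where `q_L` is the number of elements of
the residue field of `L`. -/
def IsFrobOver (L : IntermediateField K (SeparableClosure K)) (σ : AbsGal K) : Prop :=
  σ ∈ L.fixingSubgroup ∧ ActsAsPow σ (residueCard K L)

/-- `σ` acts on the residue field of `K^s` as `x ↦ x ^ (q ^ d)`, for an integer `d` that may be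
negative: writing `d = n - m`, one has `σ(x) ^ (q ^ m) = x ^ (q ^ n)` in the residue field. -/
def HasFrobDegree (σ : AbsGal K) (d : ℤ) : Prop :=
  ∃ m n : ℕ, (n : ℤ) - m = d ∧ ∀ x : intRing K (SeparableClosure K),
    (σ • x) ^ (resCard K ^ m) - x ^ (resCard K ^ n) ∈ maxIdeal K (SeparableClosure K)

theorem HasFrobDegree.one : HasFrobDegree (1 : AbsGal K) 0 :=
  ⟨0, 0, by simp, fun x => by simp⟩

theorem HasFrobDegree.mul {σ τ : AbsGal K} {a b : ℤ} (hσ : HasFrobDegree σ a)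
    (hτ : HasFrobDegree τ b) : HasFrobDegree (σ * τ) (a + b) := by
  obtain ⟨m, n, hd, h⟩ := hσ
  obtain ⟨m', n', hd', h'⟩ := hτ
  refine ⟨m + m', n + n', by push_cast; omega, fun x => ?_⟩
  have h1 := h (τ • x)
  have h2 := h' x
  rw [← Ideal.Quotient.eq, map_pow, map_pow] at h1 h2 ⊢
  rw [mul_smul, pow_add, pow_mul, h1, ← pow_mul, mul_comm, pow_mul, h2, ← pow_mul, pow_add,
    mul_comm]

theorem HasFrobDegree.inv {σ : AbsGal K} {a : ℤ} (hσ : HasFrobDegree σ a) :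
    HasFrobDegree σ⁻¹ (-a) := by
  obtain ⟨m, n, hd, h⟩ := hσ
  refine ⟨n, m, by omega, fun x => ?_⟩
  have h1 := h (σ⁻¹ • x)
  rw [← Ideal.Quotient.eq] at h1 ⊢
  rw [smul_inv_smul] at h1
  exact h1.symm

variable (K)

/-- The Weil group of `K`: the elements of the absolute Galois group that act on the residue field
of `K^s` as an integral power of Frobenius. -/
noncomputable def weilGroup : Subgroup (AbsGal K) where
  carrier := {σ | ∃ d : ℤ, HasFrobDegree σ d}
  mul_mem' := fun ⟨_, ha⟩ ⟨_, hb⟩ => ⟨_, ha.mul hb⟩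
  one_mem' := ⟨0, HasFrobDegree.one⟩
  inv_mem' := fun ⟨_, ha⟩ => ⟨_, ha.inv⟩

/-- The inertia group of `K`: the elements of the absolute Galois group that act trivially on the
residue field of `K^s`.  For `L/K` algebraic inside `K^s`, the inertia group of `L` is the
intersection of this group with `Gal(K^s/L)`. -/
noncomputable def inertiaGroup : Subgroup (AbsGal K) :=
  (maxIdeal K (SeparableClosure K)).inertia (AbsGal K)

end Galois

/-! ### Weil–Deligne representations -/

/-- A Weil–Deligne representation of the local field `K` on the `E`-vector space `V` (meant to be
finite-dimensional over the field `E` of characteristic zero): a representation of the Weil group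
with open kernel (i.e. trivial on an open subgroup of the inertia group) and a nilpotent
endomorphism `N` such that `ρ(w) N ρ(w)⁻¹ = ‖w‖ N`, where `‖w‖ = q ^ d` if `w` acts on the residue
field of `K^s` as `x ↦ x ^ (q ^ d)`. -/
structure WeilDeligneRep (K E V : Type*) [Field K] [ValuativeRel K] [Field E] [AddCommGroup V]
    [Module E V] where
  /-- the underlying Weil representation `ρ_Weil` -/
  weil : Representation E (weilGroup K) V
  /-- the monodromy operator -/
  N : Module.End E V
  smooth : ∃ U : Subgroup (AbsGal K), IsOpen (U : Set (AbsGal K)) ∧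
    ∀ w : weilGroup K, (w : AbsGal K) ∈ inertiaGroup K → (w : AbsGal K) ∈ U → weil w = 1
  nilpotent : IsNilpotent N
  weil_N : ∀ (w : weilGroup K) (d : ℤ), HasFrobDegree (w : AbsGal K) d →
    weil w ∘ₗ N = ((resCard K : E) ^ d) • (N ∘ₗ weil w)

namespace WeilDeligneRep

variable {K E V V' : Type*} [Field K] [ValuativeRel K] [Field E]
  [AddCommGroup V] [Module E V] [AddCommGroup V'] [Module E V']

/-- Isomorphism of Weil–Deligne representations: an isomorphism of the Weil representations that
commutes with the monodromy operators. -/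
def IsIsomorphic (ρ : WeilDeligneRep K E V) (ρ' : WeilDeligneRep K E V') : Prop :=
  ∃ e : ρ.weil.Equiv ρ'.weil, ∀ v : V, e (ρ.N v) = ρ'.N (e v)

/-- Frobenius-semisimplicity: Frobenius elements of `K` act semisimply. -/
def IsFrobSemisimple (ρ : WeilDeligneRep K E V) : Prop :=
  ∀ w : weilGroup K, IsFrob (w : AbsGal K) → Module.End.IsSemisimple (ρ.weil w)

/-- The Weil representation is unramified over `L`: the inertia group of `L` acts trivially. -/
def IsUnramifiedOver (ρ : WeilDeligneRep K E V)
    (L : IntermediateField K (SeparableClosure K)) : Prop :=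
  ∀ w : weilGroup K, (w : AbsGal K) ∈ inertiaGroup K → (w : AbsGal K) ∈ L.fixingSubgroup →
    ρ.weil w = 1

theorem weil_N_pow (ρ : WeilDeligneRep K E V) (w : weilGroup K) (d : ℤ)
    (hd : HasFrobDegree (w : AbsGal K) d) (k : ℕ) (v : V) :
    ρ.weil w ((ρ.N ^ k) v) = (((resCard K : E) ^ d) ^ k) • (ρ.N ^ k) (ρ.weil w v) := by
  induction k generalizing v with
  | zero => simp
  | succ k ih =>
    have h := LinearMap.congr_fun (ρ.weil_N w d hd) v
    simp only [LinearMap.comp_apply, LinearMap.smul_apply] at h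
    rw [pow_succ, Module.End.mul_apply, ih, h, map_smul, smul_smul, ← pow_succ,
      Module.End.mul_apply]

theorem range_N_pow_le_comap (ρ : WeilDeligneRep K E V) (k : ℕ) (w : weilGroup K) :
    LinearMap.range (ρ.N ^ k) ≤ (LinearMap.range (ρ.N ^ k)).comap (ρ.weil w) := by
  rintro _ ⟨v, rfl⟩
  obtain ⟨d, hd⟩ := w.2
  rw [Submodule.mem_comap, ρ.weil_N_pow w d hd]
  exact Submodule.smul_mem _ _ ⟨_, rfl⟩

variable [TopologicalSpace K] [IsNonarchimedeanLocalField K] [CharZero E]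

theorem ker_N_le_comap (ρ : WeilDeligneRep K E V) (w : weilGroup K) :
    LinearMap.ker ρ.N ≤ (LinearMap.ker ρ.N).comap (ρ.weil w) := by
  intro v hv
  obtain ⟨d, hd⟩ := w.2
  have h := LinearMap.congr_fun (ρ.weil_N w d hd) v
  have hq : ((resCard K : E) ^ d) ≠ 0 := zpow_ne_zero _ (Nat.cast_ne_zero.mpr Nat.card_pos.ne')
  rw [LinearMap.mem_ker] at hv
  simp only [LinearMap.comp_apply, LinearMap.smul_apply, hv, map_zero] at h
  rw [Submodule.mem_comap, LinearMap.mem_ker]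
  exact (smul_eq_zero.mp h.symm).resolve_left hq

/-- The Weil representation `ρ^{N=0}` on the kernel of `N`. -/
noncomputable def kerN (ρ : WeilDeligneRep K E V) : Representation E (weilGroup K) (LinearMap.ker ρ.N) :=
  ρ.weil.subrepresentation (LinearMap.ker ρ.N) ρ.ker_N_le_comap

/-- The subspace `ker N ∩ im N ^ k` of `ker N`. -/
noncomputable def kerFil (ρ : WeilDeligneRep K E V) (k : ℕ) : Submodule E (LinearMap.ker ρ.N) :=
  (LinearMap.range (ρ.N ^ k)).comap (LinearMap.ker ρ.N).subtype

theorem kerFil_le_comap (ρ : WeilDeligneRep K E V) (k : ℕ) (w : weilGroup K) :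
    ρ.kerFil k ≤ (ρ.kerFil k).comap (ρ.kerN w) :=
  fun _ hv => ρ.range_N_pow_le_comap k w hv

/-- The Weil representation on `ker N ∩ im N ^ k`. -/
noncomputable def kerFilRep (ρ : WeilDeligneRep K E V) (k : ℕ) : Representation E (weilGroup K) (ρ.kerFil k) :=
  ρ.kerN.subrepresentation (ρ.kerFil k) (ρ.kerFil_le_comap k)

/-- For `n ≥ 1`, the Weil representation `ρ_n = (ker N ∩ im N ^ (n - 1)) / (ker N ∩ im N ^ n)`.

If `ρ = ⨁ ρ_n ⊗ Sp_n` with Weil representations `ρ_n`, where `Sp_n` is the special representation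
of dimension `n`, normalised so that the Weil group acts trivially on the line `ker N` of `Sp_n`,
then `ker N = ⨁ ρ_n` and `ker N ∩ im N ^ k` is the sum of the `ρ_n` with `n > k`, so that this
quotient is the multiplicity representation `ρ_n`.  (Only `n ≥ 1` is used.) -/
noncomputable def primitivePart (ρ : WeilDeligneRep K E V) (n : ℕ) :
    Representation E (weilGroup K)
      (ρ.kerFil (n - 1) ⧸ (ρ.kerFil n).comap (ρ.kerFil (n - 1)).subtype) :=
  (ρ.kerFilRep (n - 1)).quotient ((ρ.kerFil n).comap (ρ.kerFil (n - 1)).subtype)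
    (fun w _ hv => ρ.kerFil_le_comap n w hv)

end WeilDeligneRep

/-- `α` is a Weil number of absolute value `r`: it is algebraic over `ℚ`, and all its complex
conjugates have absolute value `r`. -/
def IsWeilNumber {F : Type*} [Field F] [CharZero F] (α : F) (r : ℝ) : Prop :=
  IsAlgebraic ℚ α ∧ ∀ z : ℂ, Polynomial.aeval z (minpoly ℚ α) = 0 → ‖z‖ = r

/-- Weight-monodromy compatibility: for every `n ≥ 1`, the eigenvalues (in an algebraic closure of
the coefficient field) of arithmetic Frobenius elements of `K` on `ρ_n` are Weil numbers of
absolute value `q ^ ((n - 1) / 2)`. -/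
def WeilDeligneRep.IsWeightMonodromyCompatible {K E V : Type*} [Field K] [ValuativeRel K]
    [TopologicalSpace K] [IsNonarchimedeanLocalField K] [Field E] [CharZero E]
    [AddCommGroup V] [Module E V] [FiniteDimensional E V] (ρ : WeilDeligneRep K E V) : Prop :=
  ∀ n : ℕ, 1 ≤ n → ∀ w : weilGroup K, IsFrob (w : AbsGal K) → ∀ α : AlgebraicClosure E,
    Polynomial.aeval α (ρ.primitivePart n w).charpoly = 0 →
      IsWeilNumber α ((resCard K : ℝ) ^ (((n : ℝ) - 1) / 2))

/-!
Write `R_k = im N ^ k`. The proof recovers `(ρ, N)` in two steps: the Weil representation on `ker N`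
is recovered from the traces, and the monodromy operator from the weights.

*The Weil representation on `ker N`.* Let `w` be an element of the Weil group of degree `d ≥ 1`, and
`U` an open subgroup of the Galois group. Then `w` is a Frobenius element of a finite extension `L`
of `K` whose inertia group lies in `U` (`exists_isFrobOver`): one takes the fixed field of the group
generated by `w` and a small open normal subgroup that also fixes the unramified extension of degree
`d n` of `K`, where `n` is such that `w ^ n` is small; no power of `w` is then inertial without
being small. So the hypothesis gives the trace of every element of positive degree. For a Frobenius
element `φ`, the sequence of the traces of `w φ ^ k` satisfies a linear recurrence that can be run
backwards, so that it is determined by its terms for large `k`; hence the traces agree on the whole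
Weil group (`trace_kerN_eq`). Inertia acts through a finite group and `φ` acts semisimply, so both
Weil representations are semisimple (`hasInvariantProjections_weil`). In characteristic zero
semisimple representations are determined by their traces (`exists_equiv_of_trace_eq`), and
`ker N ≅ ker N'` as Weil representations.

*The monodromy operator.* The graded pieces of the filtration of `ker N` by the `ker N ∩ R_k` have
Frobenius eigenvalues of different absolute values, so that an isomorphism `ker N ≅ ker N'` respects
the filtrations (`map_mem_kerFil`). It then extends to `V`, by descending induction on `k` from
`R_k = 0` to `R_0 = V` (`exists_extension`): a map already defined on `R_(k+1)` and on `ker N ∩ R_k`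
is extended to an equivariant complement in `R_k` by lifting its composite with `N` through `N'`.
The result is injective since it is injective on `ker N`; by symmetry the dimensions agree.
-/

/-! ### The ring of integers of an algebraic extension is local -/

section LocalRing

/-- The spectral norm of an algebraic extension `M` of `K`: a multiplicative nonarchimedean norm
whose unit ball is the integral closure of `𝒪[K]`. -/
theorem exists_norm_le_one_iff_isIntegral (K : Type*) [Field K] [ValuativeRel K]
    [TopologicalSpace K] [IsNonarchimedeanLocalField K] (M : Type*) [Field M] [Algebra K M]
    [Algebra.IsAlgebraic K M] :
    ∃ f : M → ℝ, f 0 = 0 ∧ f 1 = 1 ∧ (∀ x, 0 ≤ f x) ∧ (∀ x y, f (x * y) = f x * f y) ∧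
      (∀ x y, f (x + y) ≤ max (f x) (f y)) ∧ ∀ x, f x ≤ 1 ↔ IsIntegral 𝒪[K] x := by
  let := IsTopologicalAddGroup.rightUniformSpace K
  have := isUniformAddGroup_of_addCommGroup (G := K)
  let : (Valued.v (R := K)).RankOne :=
  { hom' := IsRankLeOne.nonempty.some.emb (R := K).comp MonoidWithZeroHom.ValueGroup₀.embedding
    strictMono' := IsRankLeOne.nonempty.some.strictMono.comp
        MonoidWithZeroHom.ValueGroup₀.embedding_strictMono }
  let : NontriviallyNormedField K := Valued.toNontriviallyNormedField K (ValueGroupWithZero K)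
  have : IsUltrametricDist K := inferInstance
  have : CompleteSpace K := inferInstance
  refine ⟨spectralNorm K M, spectralNorm_zero, spectralNorm_one, spectralNorm_nonneg,
    fun x y => spectralAlgNorm_mul x y, fun x y => isNonarchimedean_spectralNorm x y, fun x => ?_⟩
  have hx : IsIntegral K x := Algebra.IsIntegral.isIntegral x
  have key : ∀ y : K, ‖y‖ ≤ 1 ↔ y ∈ 𝒪[K] := fun y => by
    rw [Valued.toNormedField.norm_le_one_iff]
    rfl
  rw [spectralNorm, spectralValue_le_one_iff (minpoly.monic hx)]
  constructor
  · intro h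
    have hl : minpoly K x ∈ Polynomial.lifts (algebraMap 𝒪[K] K) := by
      rw [Polynomial.lifts_iff_coeff_lifts]
      exact fun n => ⟨⟨_, (key _).1 (h n)⟩, rfl⟩
    obtain ⟨p, hp, -, hm⟩ := Polynomial.lifts_and_degree_eq_and_monic hl (minpoly.monic hx)
    refine ⟨p, hm, ?_⟩
    rw [IsScalarTower.algebraMap_eq 𝒪[K] K M, ← Polynomial.eval₂_map, hp]
    exact minpoly.aeval K x
  · intro h n
    rw [minpoly.isIntegrallyClosed_eq_field_fractions' K h, Polynomial.coeff_map, key]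
    exact Subtype.property _

instance intRing_isLocalRing (K : Type*) [Field K] [ValuativeRel K] [TopologicalSpace K]
    [IsNonarchimedeanLocalField K] (M : Type*) [Field M] [Algebra K M] [Algebra.IsAlgebraic K M] :
    IsLocalRing (intRing K M) := by
  obtain ⟨f, h0, h1, hnn, hmul, hadd, hint⟩ := exists_norm_le_one_iff_isIntegral K M
  have hle : ∀ x : intRing K M, f x ≤ 1 := fun x => (hint _).2 x.2
  have hunit : ∀ x : intRing K M, IsUnit x ↔ f x = 1 := by
    intro x
    constructor
    · intro h
      obtain ⟨y, hy⟩ := h.exists_right_inv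
      have h2 : f x * f y = 1 := by rw [← hmul, ← MulMemClass.coe_mul, hy]; exact h1
      nlinarith [hle x, hle y, hnn x, hnn y]
    · intro h
      have hx0 : (x : M) ≠ 0 := fun hx => by rw [hx, h0] at h; exact zero_ne_one h
      have h2 := hmul (x : M) (x : M)⁻¹
      rw [mul_inv_cancel₀ hx0, h1, h, one_mul] at h2
      refine IsUnit.of_mul_eq_one ⟨(x : M)⁻¹, (hint _).1 h2.ge⟩ (Subtype.ext ?_)
      exact mul_inv_cancel₀ hx0
  refine IsLocalRing.of_nonunits_add fun a b ha hb => ?_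
  rw [mem_nonunits_iff, hunit] at ha hb ⊢
  have ha' := lt_of_le_of_ne (hle a) ha
  have hb' := lt_of_le_of_ne (hle b) hb
  exact ((hadd a b).trans_lt (max_lt ha' hb')).ne

theorem maxIdeal_eq (K : Type*) [Field K] [ValuativeRel K] [TopologicalSpace K]
    [IsNonarchimedeanLocalField K] (M : Type*) [Field M] [Algebra K M] [Algebra.IsAlgebraic K M] :
    maxIdeal K M = IsLocalRing.maximalIdeal (intRing K M) := by
  exact IsLocalRing.ringJacobson_eq_maximalIdeal _
end LocalRing

/-! ### Residue fields and roots of unity -/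

section ResidueField

open Polynomial

variable (K : Type*) [Field K] [ValuativeRel K] [TopologicalSpace K] [IsNonarchimedeanLocalField K]

instance maxIdeal_isMaximal (M : Type*) [Field M] [Algebra K M] [Algebra.IsAlgebraic K M] :
    (maxIdeal K M).IsMaximal := by
  rw [maxIdeal_eq]
  infer_instance

instance quotient_maxIdeal_isDomain (M : Type*) [Field M] [Algebra K M] [Algebra.IsAlgebraic K M] :
    IsDomain (intRing K M ⧸ maxIdeal K M) :=
  Ideal.Quotient.isDomain _

instance quotient_maxIdeal_nontrivial (M : Type*) [Field M] [Algebra K M]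
    [Algebra.IsAlgebraic K M] : Nontrivial (intRing K M ⧸ maxIdeal K M) :=
  (quotient_maxIdeal_isDomain K M).toNontrivial

instance maxIdeal_liesOver (M : Type*) [Field M] [Algebra K M] [Algebra.IsAlgebraic K M] :
    (maxIdeal K M).LiesOver 𝓂[K] :=
  ⟨(IsLocalRing.eq_maximalIdeal
    (Ideal.isMaximal_comap_of_isIntegral_of_isMaximal (R := 𝒪[K]) (maxIdeal K M))).symm⟩

theorem natCast_mem_maxIdeal {r : ℕ} (hr : (r : 𝒪[K]) ∈ 𝓂[K]) (M : Type*) [Field M] [Algebra K M]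
    [Algebra.IsAlgebraic K M] : (r : intRing K M) ∈ maxIdeal K M := by
  rw [(maxIdeal_liesOver K M).over] at hr
  simpa using hr

theorem mem_maxIdeal_iff (M : Type*) [Field M] [Algebra K M] [Algebra.IsAlgebraic K M]
    (x : intRing K M) : x ∈ maxIdeal K M ↔ ¬ IsUnit x := by
  rw [maxIdeal_eq]
  rfl

theorem exists_resCard_eq_prime_pow : ∃ p f : ℕ, p.Prime ∧ f ≠ 0 ∧ resCard K = p ^ f ∧
    (p : 𝒪[K]) ∈ 𝓂[K] := by
  obtain ⟨p, hp⟩ := CharP.exists 𝓀[K]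
  have := Fintype.ofFinite 𝓀[K]
  obtain ⟨f, hpp, hf⟩ := FiniteField.card 𝓀[K] p
  refine ⟨p, f, hpp, f.ne_zero, by rw [resCard, Nat.card_eq_fintype_card, hf], ?_⟩
  rw [← IsLocalRing.residue_eq_zero_iff, map_natCast, CharP.cast_eq_zero]

theorem one_lt_resCard : 1 < resCard K := by
  obtain ⟨p, f, hp, hf, h, -⟩ := exists_resCard_eq_prime_pow K
  rw [h]
  exact Nat.one_lt_pow hf hp.one_lt

theorem resCard_pow_mem {d : ℕ} (hd : d ≠ 0) : ((resCard K ^ d : ℕ) : 𝒪[K]) ∈ 𝓂[K] := by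
  obtain ⟨p, f, hp, hf, h, hM⟩ := exists_resCard_eq_prime_pow K
  rw [h, ← pow_mul, Nat.cast_pow]
  exact Ideal.pow_mem_of_mem _ hM _ (Nat.pos_of_ne_zero (mul_ne_zero hf hd))

variable {K}

/-- The `q ^ m`-power map is injective on the residue field of an algebraic extension. -/
theorem sub_mem_maxIdeal_of_pow_sub_pow {M : Type*} [Field M] [Algebra K M]
    [Algebra.IsAlgebraic K M] {x y : intRing K M} (m : ℕ)
    (h : x ^ resCard K ^ m - y ^ resCard K ^ m ∈ maxIdeal K M) : x - y ∈ maxIdeal K M := by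
  obtain ⟨p, f, hp, hf, hq, hM⟩ := exists_resCard_eq_prime_pow K
  have := Fact.mk hp
  have : CharP (intRing K M ⧸ maxIdeal K M) p := by
    rw [CharP.charP_iff_prime_eq_zero hp, ← map_natCast (Ideal.Quotient.mk (maxIdeal K M)),
      Ideal.Quotient.eq_zero_iff_mem]
    exact natCast_mem_maxIdeal K hM M
  rw [← Ideal.Quotient.eq, map_pow, map_pow, hq, ← pow_mul] at h
  rw [← Ideal.Quotient.eq]
  exact iterateFrobenius_inj _ p (f * m) (by simpa only [iterateFrobenius_def] using h)

/-- Over a separable closure of `K` the polynomial `X ^ r - X`, for `r` in the maximal ideal, is a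
product of distinct linear factors with integral roots. -/
theorem exists_finset_pow_eq_self {r : ℕ} (hr1 : 1 < r) (hr : (r : 𝒪[K]) ∈ 𝓂[K]) :
    ∃ R : Finset (intRing K (SeparableClosure K)), R.card = r ∧ (∀ a, a ∈ R ↔ a ^ r = a) ∧
      ∀ x, x ^ r - x = ∏ a ∈ R, (x - a) := by
  classical
  have hrK : ((r : K) - 1) ≠ 0 := by
    intro h0
    have h1 : (r : 𝒪[K]) = 1 := by
      apply Subtype.ext
      simpa using sub_eq_zero.1 h0
    rw [h1] at hr
    exact (Ideal.ne_top_iff_one _).1 (IsLocalRing.maximalIdeal.isMaximal 𝒪[K]).ne_top hr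
  set F : K[X] := X ^ r - X with hF
  have hmon : F.Monic := monic_X_pow_sub (by rw [degree_X]; exact_mod_cast hr1)
  have hdeg : F.natDegree = r := by
    rw [hF, natDegree_sub_eq_left_of_natDegree_lt] <;> simp [hr1]
  -- `X F' - r F = (r - 1) X`, where `r - 1 ≠ 0`, and `F' = -1` modulo `X`
  have hsep : F.Separable := by
    obtain ⟨s, rfl⟩ : ∃ s, r = s + 2 := ⟨r - 2, by omega⟩
    set c : K := ((s + 2 : ℕ) : K) with hc
    refine ⟨-(C (c * c / (c - 1)) * X ^ s), C (c / (c - 1)) * X ^ (s + 1) - 1, ?_⟩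
    have hd : derivative F = C c * X ^ (s + 1) - 1 := by
      rw [hF, derivative_sub, derivative_X_pow, derivative_X, hc]
      rfl
    rw [hd, hF]
    have e1 : C (c * c / (c - 1)) = C (c / (c - 1)) * C c := by rw [← C_mul]; congr 1; ring
    have e2 : C (c / (c - 1)) * (C c - 1) = C c := by
      rw [← C_1, ← C_sub, ← C_mul]; congr 1; field_simp
    rw [e1]
    have : -(C (c / (c - 1)) * C c * X ^ s) * (X ^ (s + 2) - X) +
        (C (c / (c - 1)) * X ^ (s + 1) - 1) * (C c * X ^ (s + 1) - 1) =
        (C (c / (c - 1)) * (C c - 1)) * X ^ (s + 1) - C c * X ^ (s + 1) + 1 := by ring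
    rw [this, e2]; ring
  have hspl : (F.map (algebraMap K (SeparableClosure K))).Splits :=
    IsSepClosed.splits_codomain F hsep
  have hnd : (F.map (algebraMap K (SeparableClosure K))).roots.Nodup :=
    nodup_roots hsep.map
  set G := F.map (algebraMap K (SeparableClosure K)) with hG
  have hGmon : G.Monic := hmon.map _
  have hroot : ∀ a, a ∈ G.roots ↔ a ^ r = a := by
    intro a
    rw [mem_roots hGmon.ne_zero, IsRoot, hG, hF]
    simp [sub_eq_zero]
  have hint : ∀ a : SeparableClosure K, a ^ r = a → IsIntegral 𝒪[K] a := fun a ha =>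
    ⟨X ^ r - X, monic_X_pow_sub (by rw [degree_X]; exact_mod_cast hr1), by simp [ha]⟩
  let e : {x // x ∈ G.roots.toFinset} → intRing K (SeparableClosure K) := fun x =>
    ⟨x.1, hint _ ((hroot _).1 (Multiset.mem_toFinset.1 x.2))⟩
  have he : Function.Injective e := fun x y h => Subtype.ext (congrArg (fun z => z.1) h)
  refine ⟨G.roots.toFinset.attach.map ⟨e, he⟩, ?_, ?_, ?_⟩
  · rw [Finset.card_map, Finset.card_attach, Multiset.toFinset_card_of_nodup hnd,
      ← hspl.natDegree_eq_card_roots, hG, natDegree_map, hdeg]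
  · intro a
    simp only [Finset.mem_map, Finset.mem_attach, true_and, Function.Embedding.coeFn_mk]
    constructor
    · rintro ⟨x, rfl⟩
      exact Subtype.ext ((hroot _).1 (Multiset.mem_toFinset.1 x.2))
    · intro ha
      exact ⟨⟨a.1, by rw [Multiset.mem_toFinset, hroot, ← SubmonoidClass.coe_pow, ha]⟩, rfl⟩
  · intro x
    apply Subtype.ext
    have h := hspl.eval_eq_prod_roots_of_monic hGmon x.1
    have h2 : eval x.1 G = x.1 ^ r - x.1 := by simp [hG, hF]
    have h3 : (Multiset.map (fun a => x.1 - a) G.roots).prod =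
        ∏ a ∈ G.roots.toFinset, (x.1 - a) := by
      rw [Finset.prod, Multiset.toFinset_val, hnd.dedup]
    rw [Finset.prod_map, AddSubgroupClass.coe_sub, SubmonoidClass.coe_pow, ← h2, h, h3,
      ← Finset.prod_attach, ← Subalgebra.coe_val, map_prod]
    rfl

/-- Distinct roots of `X ^ r - X` stay distinct modulo the maximal ideal, if `r` lies in it. -/
theorem eq_of_sub_mem_maxIdeal {r : ℕ} {M : Type*} [Field M] [Algebra K M]
    [Algebra.IsAlgebraic K M] (hr : (r : intRing K M) ∈ maxIdeal K M) {a b : intRing K M}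
    (ha : a ^ r = a) (hb : b ^ r = b) (hab : a - b ∈ maxIdeal K M) : a = b := by
  by_contra hne
  -- if `a ≠ b`, the sum of the `a ^ i b ^ (r - 1 - i)` is `1`,
  -- but it is congruent to `r a ^ (r - 1)`
  have h1 := Commute.geom_sum₂_mul (Commute.all a b) r
  rw [ha, hb] at h1
  have h2 : (∑ i ∈ Finset.range r, a ^ i * b ^ (r - 1 - i)) = 1 :=
    mul_right_cancel₀ (sub_ne_zero.2 hne) (by rw [h1, one_mul])
  have h3 : Ideal.Quotient.mk (maxIdeal K M)
      (∑ i ∈ Finset.range r, a ^ i * b ^ (r - 1 - i)) = 0 := by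
    have hab' := Ideal.Quotient.eq.2 hab
    simp only [map_sum, map_mul, map_pow, hab']
    rw [geom_sum₂_self, ← map_pow, ← map_natCast (Ideal.Quotient.mk (maxIdeal K M)),
       ← map_mul]
    exact Ideal.Quotient.eq_zero_iff_mem.2 (Ideal.mul_mem_right _ _ hr)
  rw [h2, map_one] at h3
  exact one_ne_zero h3

end ResidueField

/-! ### Frobenius elements of finite extensions -/

section Frobenius

variable {K : Type*} [Field K] [ValuativeRel K]

variable (K) in
theorem intRing_isInvariant :
    Algebra.IsInvariant 𝒪[K] (intRing K (SeparableClosure K)) (AbsGal K) where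
  isInvariant b hb := by
    obtain ⟨a, ha⟩ := (InfiniteGalois.mem_range_algebraMap_iff_fixed (k := K) b.1).2
      fun σ => congrArg Subtype.val (hb σ)
    have h1 : IsIntegral 𝒪[K] a := by
      have := b.2
      rw [← ha] at this
      exact (isIntegral_algebraMap_iff (algebraMap K (SeparableClosure K)).injective).1 this
    obtain ⟨c, hc⟩ := IsIntegrallyClosed.isIntegral_iff.1 h1
    refine ⟨c, Subtype.ext ?_⟩
    rw [← ha, ← hc]
    rfl

theorem IsFrob.hasFrobDegree {σ : AbsGal K} (h : IsFrob σ) : HasFrobDegree σ 1 :=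
  ⟨0, 1, by simp, by simpa [IsFrob, ActsAsPow] using h⟩

theorem HasFrobDegree.pow {σ : AbsGal K} {d : ℤ} (h : HasFrobDegree σ d) (n : ℕ) :
    HasFrobDegree (σ ^ n) (n * d) := by
  induction n with
  | zero => simpa using HasFrobDegree.one
  | succ n ih =>
    rw [pow_succ]
    convert ih.mul h using 1
    push_cast; ring

theorem HasFrobDegree.zpow {σ : AbsGal K} {d : ℤ} (h : HasFrobDegree σ d) (k : ℤ) :
    HasFrobDegree (σ ^ k) (k * d) := by
  obtain ⟨n, rfl | rfl⟩ := k.eq_nat_or_neg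
  · rw [zpow_natCast]
    exact h.pow n
  · rw [zpow_neg, zpow_natCast, neg_mul]
    exact (h.pow n).inv

theorem ActsAsPow.hasFrobDegree {σ : AbsGal K} {d : ℕ} (h : ActsAsPow σ (resCard K ^ d)) :
    HasFrobDegree σ d :=
  ⟨0, d, by simp, by simpa [ActsAsPow] using h⟩

theorem hasFrobDegree_of_mem_inertiaGroup {σ : AbsGal K} (h : σ ∈ inertiaGroup K) :
    HasFrobDegree σ 0 :=
  ⟨0, 0, by simp, fun x => by simpa using h x⟩

theorem pow_resCard_pow_eq_self {a : intRing K (SeparableClosure K)} {d n : ℕ}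
    (ha : a ^ resCard K ^ d = a) : a ^ resCard K ^ (d * n) = a := by
  induction n with
  | zero => simp
  | succ n ih => rw [mul_add, pow_add, pow_mul, ih, mul_one, ha]

variable [TopologicalSpace K] [IsNonarchimedeanLocalField K]

variable (K) in
/-- Frobenius elements exist, since the Galois group surjects onto that of the residue field. -/
theorem exists_isFrob : ∃ σ : AbsGal K, IsFrob σ := by
  have := intRing_isInvariant K
  let : TopologicalSpace (intRing K (SeparableClosure K)) := ⊥
  have : DiscreteTopology (intRing K (SeparableClosure K)) := ⟨rfl⟩
  have : ContinuousSMul (AbsGal K) (intRing K (SeparableClosure K)) := by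
    rw [continuousSMul_iff_stabilizer_isOpen]
    intro x
    exact Subgroup.isOpen_mono
      (fun σ (hσ : σ ∈ MulAction.stabilizer (AbsGal K) x.1) => Subtype.ext hσ)
      (stabilizer_isOpen_of_isIntegral (K := K) x.1)
  let : Field (𝒪[K] ⧸ 𝓂[K]) := Ideal.Quotient.field _
  let : Field (intRing K (SeparableClosure K) ⧸ maxIdeal K (SeparableClosure K)) :=
    Ideal.Quotient.field _
  have : Finite (𝒪[K] ⧸ 𝓂[K]) := inferInstanceAs (Finite 𝓀[K])
  have := Fintype.ofFinite (𝒪[K] ⧸ 𝓂[K])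
  have : Algebra.IsAlgebraic (𝒪[K] ⧸ 𝓂[K])
      (intRing K (SeparableClosure K) ⧸ maxIdeal K (SeparableClosure K)) := by
    have : Algebra.IsIntegral 𝒪[K] (intRing K (SeparableClosure K)) := inferInstance
    have : Algebra.IsIntegral (𝒪[K] ⧸ 𝓂[K])
      (intRing K (SeparableClosure K) ⧸ maxIdeal K (SeparableClosure K)) := inferInstance
    exact ⟨fun x => (Algebra.IsIntegral.isIntegral x).isAlgebraic⟩
  obtain ⟨σ, hσ⟩ := Ideal.Quotient.stabilizerHom_surjective_of_profinite (G := AbsGal K) 𝓂[K]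
    (maxIdeal K (SeparableClosure K)) (FiniteField.frobeniusAlgEquivOfAlgebraic _ _)
  refine ⟨σ, fun x => ?_⟩
  rw [← Ideal.Quotient.eq]
  have h := DFunLike.congr_fun hσ (Ideal.Quotient.mk _ x)
  rw [Ideal.Quotient.stabilizerHom_apply, FiniteField.coe_frobeniusAlgEquivOfAlgebraic] at h
  have hc : Fintype.card (𝒪[K] ⧸ 𝓂[K]) = resCard K := Nat.card_eq_fintype_card.symm
  rw [hc] at h
  rw [map_pow]
  exact h

theorem HasFrobDegree.actsAsPow {σ : AbsGal K} {d : ℕ} (h : HasFrobDegree σ d) :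
    ActsAsPow σ (resCard K ^ d) := by
  obtain ⟨m, n, hd, h⟩ := h
  obtain rfl : n = d + m := by omega
  intro x
  apply sub_mem_maxIdeal_of_pow_sub_pow m
  rw [← pow_mul, ← pow_add]
  exact h x

theorem HasFrobDegree.mem_inertiaGroup {σ : AbsGal K} (h : HasFrobDegree σ 0) :
    σ ∈ inertiaGroup K := fun x => by
  simpa using HasFrobDegree.actsAsPow (d := 0) h x

theorem one_lt_resCard_pow {d : ℕ} (hd : d ≠ 0) : 1 < resCard K ^ d :=
  Nat.one_lt_pow hd (one_lt_resCard K)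

/-- The action on the roots of `X ^ (q ^ e) - X` is determined by the action on the residue
field. -/
theorem ActsAsPow.smul_eq_self {σ : AbsGal K} {d e : ℕ} (he : e ≠ 0)
    (h : ActsAsPow σ (resCard K ^ d)) {a : intRing K (SeparableClosure K)}
    (ha : a ^ resCard K ^ e = a) (hd : a ^ resCard K ^ d = a) : σ • a = a := by
  refine eq_of_sub_mem_maxIdeal (natCast_mem_maxIdeal K (resCard_pow_mem K he) _) ?_ ha ?_
  · rw [← smul_pow', ha]
  · have := h a
    rwa [hd] at this

/-- A residual power map fixing all roots of `X ^ (q ^ e) - X` has degree zero or at least `e`. -/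
theorem le_of_actsAsPow_of_fixed {σ : AbsGal K} {d e : ℕ} (hd : d ≠ 0) (he : e ≠ 0)
    (h : ActsAsPow σ (resCard K ^ d))
    (hfix : ∀ a : intRing K (SeparableClosure K), a ^ resCard K ^ e = a → σ • a = a) : e ≤ d := by
  obtain ⟨R, hR, hmem, -⟩ :=
    exists_finset_pow_eq_self (one_lt_resCard_pow he) (resCard_pow_mem K he)
  obtain ⟨S, hS, hmemS, hprod⟩ :=
    exists_finset_pow_eq_self (one_lt_resCard_pow hd) (resCard_pow_mem K hd)
  have key : ∀ a ∈ R, ∃ b ∈ S, a - b ∈ maxIdeal K (SeparableClosure K) := by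
    intro a ha
    have h1 := h a
    rw [hfix a ((hmem a).1 ha), ← neg_mem_iff, neg_sub, hprod] at h1
    exact (Ideal.IsPrime.prod_mem_iff).1 h1
  choose! g hg hg' using key
  have hle : R.card ≤ S.card := by
    refine Finset.card_le_card_of_injOn g hg fun a ha b hb hab => ?_
    refine eq_of_sub_mem_maxIdeal (natCast_mem_maxIdeal K (resCard_pow_mem K he) _)
      ((hmem a).1 ha) ((hmem b).1 hb) ?_
    have := sub_mem (hg' a ha) (hg' b hb)
    rw [hab] at this
    simpa using this
  rw [hR, hS] at hle
  exact (Nat.pow_le_pow_iff_right (one_lt_resCard K)).1 hle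

/-- If the residues of the integers of `L` satisfy `x ^ (q ^ d) = x`, and if `L` contains all
roots of `X ^ (q ^ d) - X`, then these roots represent the residue field of `L`. -/
theorem residueCard_eq {d : ℕ} (hd : d ≠ 0) (L : IntermediateField K (SeparableClosure K))
    (hpow : ∀ x : intRing K (SeparableClosure K), x.1 ∈ L →
      x ^ resCard K ^ d - x ∈ maxIdeal K (SeparableClosure K))
    (hroots : ∀ a : intRing K (SeparableClosure K), a ^ resCard K ^ d = a → a.1 ∈ L) :
    residueCard K L = resCard K ^ d := by
  obtain ⟨R, hR, hmem, hprod⟩ :=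
    exists_finset_pow_eq_self (one_lt_resCard_pow hd) (resCard_pow_mem K hd)
  have : IsScalarTower 𝒪[K] L (SeparableClosure K) := .of_algebraMap_eq fun _ => rfl
  have hint : ∀ x : L, IsIntegral 𝒪[K] (x : SeparableClosure K) ↔ IsIntegral 𝒪[K] x := fun x =>
    isIntegral_algebraMap_iff (A := L) (B := SeparableClosure K) Subtype.val_injective
  let ι : intRing K L → intRing K (SeparableClosure K) := fun x => ⟨x.1.1, (hint _).2 x.2⟩
  have hunit : ∀ x, ι x ∈ maxIdeal K (SeparableClosure K) ↔ x ∈ maxIdeal K L := by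
    intro x
    rw [mem_maxIdeal_iff, mem_maxIdeal_iff, not_iff_not]
    constructor
    · intro h
      obtain ⟨y, hy⟩ := h.exists_right_inv
      have hy' : x.1.1 * y.1 = 1 := congrArg Subtype.val hy
      have hyL : y.1 ∈ L := by
        rw [eq_inv_of_mul_eq_one_right hy']
        exact L.inv_mem x.1.2
      exact IsUnit.of_mul_eq_one ⟨⟨y.1, hyL⟩, (hint _).1 y.2⟩ (Subtype.ext (Subtype.ext hy'))
    · intro h
      obtain ⟨y, hy⟩ := h.exists_right_inv
      exact IsUnit.of_mul_eq_one (ι y)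
        (Subtype.ext (congrArg (fun z : intRing K L => z.1.1) hy))
  let g : R → intRing K L ⧸ maxIdeal K L := fun a =>
    Ideal.Quotient.mk _ ⟨⟨a.1.1, hroots _ ((hmem _).1 a.2)⟩, (hint _).1 a.1.2⟩
  have hg : Function.Bijective g := by
    constructor
    · intro a b hab
      have h1 := (hunit _).2 (Ideal.Quotient.eq.1 hab)
      exact Subtype.ext (eq_of_sub_mem_maxIdeal
        (natCast_mem_maxIdeal K (resCard_pow_mem K hd) _) ((hmem _).1 a.2) ((hmem _).1 b.2) h1)
    · intro y
      obtain ⟨y, rfl⟩ := Ideal.Quotient.mk_surjective y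
      have h1 := hpow (ι y) y.1.2
      rw [hprod] at h1
      obtain ⟨a, ha, h2⟩ := (Ideal.IsPrime.prod_mem_iff).1 h1
      refine ⟨⟨a, ha⟩, (Ideal.Quotient.eq.2 ((hunit _).1 ?_)).symm⟩
      exact h2
  rw [residueCard, ← Nat.card_eq_of_bijective g hg, Nat.card_eq_fintype_card, Fintype.card_coe, hR]

/-- Every Weil element of positive degree is a Frobenius element of a finite extension `L` of `K`
whose inertia group is as small as desired. -/
theorem exists_isFrobOver {w : AbsGal K} {d : ℕ} (hd : d ≠ 0) (hw : ActsAsPow w (resCard K ^ d))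
    {U : Subgroup (AbsGal K)} (hU : IsOpen (U : Set (AbsGal K))) :
    ∃ L : IntermediateField K (SeparableClosure K), FiniteDimensional K L ∧ IsFrobOver L w ∧
      ∀ σ ∈ inertiaGroup K, σ ∈ L.fixingSubgroup → σ ∈ U := by
  obtain ⟨H, hHU⟩ := ProfiniteGrp.exist_openNormalSubgroup_sub_open_nhds_of_one hU U.one_mem
  have hHfin : H.toSubgroup.FiniteIndex :=
    have := H.toSubgroup.quotient_finite_of_isOpen H.isOpen'
    Subgroup.finiteIndex_of_finite_quotient
  obtain ⟨n, hn, hnH⟩ : ∃ n : ℕ, 0 < n ∧ w ^ n ∈ H.toSubgroup := by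
    obtain ⟨n, hn, -, h⟩ := H.toSubgroup.exists_pow_mem_of_index_ne_zero hHfin.index_ne_zero w
    exact ⟨n, hn, h⟩
  have he : d * n ≠ 0 := mul_ne_zero hd hn.ne'
  -- the elements of the Galois group fixing the roots of `X ^ (q ^ (d * n)) - X`
  let F : Subgroup (AbsGal K) :=
    { carrier := {σ | ∀ a : intRing K (SeparableClosure K),
        a ^ resCard K ^ (d * n) = a → σ • a = a}
      mul_mem' := fun {σ τ} hσ hτ a ha => by rw [mul_smul, hτ a ha, hσ a ha]
      one_mem' := fun a _ => one_smul _ a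
      inv_mem' := fun {σ} hσ a ha => by rw [inv_smul_eq_iff, hσ a ha] }
  have hFnormal : F.Normal := ⟨fun σ hσ τ a ha => by
    rw [mul_smul, mul_smul, hσ, smul_inv_smul]
    rw [← smul_pow', ha]⟩
  have hFopen : IsOpen (F : Set (AbsGal K)) := by
    obtain ⟨R, hR, hmem, -⟩ :=
      exists_finset_pow_eq_self (one_lt_resCard_pow he) (resCard_pow_mem K he)
    have h1 : IsOpen (⋂ a ∈ R, (MulAction.stabilizer (AbsGal K) a.1 : Set (AbsGal K))) :=
      isOpen_biInter_finset fun a _ =>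
        stabilizer_isOpen_of_isIntegral (K := K) a.1
    convert h1 using 1
    ext σ
    simp only [Set.mem_iInter, SetLike.mem_coe, MulAction.mem_stabilizer_iff, hmem]
    exact forall₂_congr fun a _ => Subtype.ext_iff
  have hwF : w ^ n ∈ F := fun a ha => by
    have h1 : ActsAsPow (w ^ n) (resCard K ^ (d * n)) := by
      apply HasFrobDegree.actsAsPow
      convert hw.hasFrobDegree.pow n using 1
      push_cast; ring
    exact h1.smul_eq_self he ha ha
  let N := H.toSubgroup ⊓ F
  have hNnormal : N.Normal := inferInstance
  have hNopen : IsOpen (N : Set (AbsGal K)) := H.isOpen'.inter hFopen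
  let S := Subgroup.zpowers w ⊔ N
  have hSopen : IsOpen (S : Set (AbsGal K)) := Subgroup.isOpen_mono le_sup_right hNopen
  let L := IntermediateField.fixedField S
  have hL : L.fixingSubgroup = S :=
    InfiniteGalois.fixingSubgroup_fixedField ⟨S, S.isClosed_of_isOpen hSopen⟩
  have hwS : w ∈ S := (le_sup_left : _ ≤ S) (Subgroup.mem_zpowers w)
  refine ⟨L, (InfiniteGalois.isOpen_iff_finite L).1 (by rwa [hL]), ⟨by rwa [hL], ?_⟩, ?_⟩
  · rw [residueCard_eq hd L]
    · exact hw
    · intro x hx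
      have h1 := hw x
      have h2 : w • x = x := Subtype.ext (hx ⟨w, hwS⟩)
      rw [h2] at h1
      rw [← neg_mem_iff, neg_sub]
      exact h1
    · intro a ha
      have h1 : S ≤ MulAction.stabilizer (AbsGal K) a := by
        refine sup_le ?_ fun σ hσ => hσ.2 a (pow_resCard_pow_eq_self ha)
        rw [Subgroup.zpowers_le]
        exact hw.smul_eq_self hd ha ha
      intro σ
      exact congrArg Subtype.val (h1 σ.2)
  · intro σ hσ hσL
    rw [hL] at hσL
    obtain ⟨y, hy, z, hz, rfl⟩ := Subgroup.mem_sup_of_normal_right.1 hσL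
    obtain ⟨j, rfl⟩ := Subgroup.mem_zpowers_iff.1 hy
    have hn' : (n : ℤ) ≠ 0 := by exact_mod_cast hn.ne'
    obtain ⟨r, hr⟩ := Int.eq_ofNat_of_zero_le (Int.emod_nonneg j hn')
    have hrn : r < n := by
      have := Int.emod_lt_of_pos j (Int.natCast_pos.2 hn)
      omega
    have hj : w ^ j = w ^ r * (w ^ n) ^ (j / n) := by
      rw [← zpow_natCast w r, ← hr, ← zpow_natCast w n, ← zpow_mul, ← zpow_add,
        Int.emod_add_mul_ediv]
    have hz' : (w ^ n) ^ (j / n) * z ∈ N := N.mul_mem (N.zpow_mem ⟨hnH, hwF⟩ _) hz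
    rw [hj, mul_assoc] at hσ ⊢
    -- for `0 < r < n` the element `w ^ r` would fix `q ^ (d n)` roots although it has degree `d r`
    rcases Nat.eq_zero_or_pos r with rfl | hr0
    · rw [pow_zero, one_mul]
      exact hHU hz'.1
    · exfalso
      have h1 : ActsAsPow (w ^ r) (resCard K ^ (d * r)) := by
        apply HasFrobDegree.actsAsPow
        convert hw.hasFrobDegree.pow r using 1
        push_cast; ring
      have h2 := le_of_actsAsPow_of_fixed (mul_ne_zero hd hr0.ne') he h1 fun a ha => by
        have h3 := eq_of_sub_mem_maxIdeal
          (natCast_mem_maxIdeal K (resCard_pow_mem K he) _) (by rw [← smul_pow', ha]) ha (hσ a)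
        rwa [mul_smul, hz'.2 a ha] at h3
      exact absurd (Nat.le_of_mul_le_mul_left h2 (Nat.pos_of_ne_zero hd)) (not_le.2 hrn)

end Frobenius

/-! ### Traces along powers of an operator -/

section TraceRecurrence

open Polynomial

variable {E V V' : Type*} [Field E] [AddCommGroup V] [Module E V] [FiniteDimensional E V]
  [AddCommGroup V'] [Module E V'] [FiniteDimensional E V']

theorem charpoly_coeff_zero_ne_zero {φ : Module.End E V} (h : IsUnit φ) :
    φ.charpoly.coeff 0 ≠ 0 := by
  have h1 := (LinearMap.isUnit_iff_isUnit_det φ).1 h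
  rw [LinearMap.det_eq_sign_charpoly_coeff] at h1
  exact fun h0 => by simp [h0] at h1

/-- Sequences `tr (a φ ^ k)` with `φ` invertible satisfy a linear recurrence that can be run
backwards, so that two of them that agree for large `k` agree everywhere. -/
theorem trace_eq_of_eventually_trace_mul_pow_eq {φ a : Module.End E V} {φ' a' : Module.End E V'}
    (hφ : IsUnit φ) (hφ' : IsUnit φ') (m : ℕ)
    (h : ∀ k ≥ m, LinearMap.trace E V (a * φ ^ k) = LinearMap.trace E V' (a' * φ' ^ k)) :
    LinearMap.trace E V a = LinearMap.trace E V' a' := by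
  induction m with
  | zero => simpa using h 0 le_rfl
  | succ m ih =>
    apply ih
    intro k hk
    rcases hk.lt_or_eq with hk | rfl
    · exact h k hk
    set P := φ.charpoly * φ'.charpoly with hP
    have hP0 : P.coeff 0 ≠ 0 := by
      rw [hP, mul_coeff_zero]
      exact mul_ne_zero (charpoly_coeff_zero_ne_zero hφ) (charpoly_coeff_zero_ne_zero hφ')
    have h1 : aeval φ P = 0 := by rw [hP, map_mul, LinearMap.aeval_self_charpoly, zero_mul]
    have h2 : aeval φ' P = 0 := by rw [hP, map_mul, LinearMap.aeval_self_charpoly, mul_zero]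
    have e1 : ∑ i ∈ Finset.range (P.natDegree + 1),
        P.coeff i * LinearMap.trace E V (a * φ ^ (m + i)) = 0 := by
      have := congrArg (fun z => LinearMap.trace E V (a * φ ^ m * z)) h1
      simpa [aeval_eq_sum_range, Finset.mul_sum, mul_assoc, pow_add] using this
    have e2 : ∑ i ∈ Finset.range (P.natDegree + 1),
        P.coeff i * LinearMap.trace E V' (a' * φ' ^ (m + i)) = 0 := by
      have := congrArg (fun z => LinearMap.trace E V' (a' * φ' ^ m * z)) h2
      simpa [aeval_eq_sum_range, Finset.mul_sum, mul_assoc, pow_add] using this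
    rw [Finset.sum_range_succ'] at e1 e2
    have e3 : ∑ i ∈ Finset.range P.natDegree,
        P.coeff (i + 1) * LinearMap.trace E V (a * φ ^ (m + (i + 1))) =
        ∑ i ∈ Finset.range P.natDegree,
        P.coeff (i + 1) * LinearMap.trace E V' (a' * φ' ^ (m + (i + 1))) :=
      Finset.sum_congr rfl fun i _ => by rw [h _ (by omega)]
    rw [e3, ← e2] at e1
    exact mul_left_cancel₀ hP0 (add_left_cancel e1)

end TraceRecurrence

/-! ### Semisimplicity and invariant projections -/

section Projections

variable {E G V : Type*} [Field E] [Group G] [AddCommGroup V] [Module E V]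

/-- A form of semisimplicity: every invariant subspace is the image of an equivariant projection. -/
def HasInvariantProjections (ρ : Representation E G V) : Prop :=
  ∀ p : Submodule E V, (∀ g, p ≤ p.comap (ρ g)) →
    ∃ e : Module.End E V, (∀ g, Commute (ρ g) e) ∧ (∀ v, e v ∈ p) ∧ ∀ v ∈ p, e v = v

/-- Averaging a projection over its finitely many conjugates. -/
theorem exists_invariant_projection_of_finite [CharZero E] (ρ : Representation E G V)
    {p : Submodule E V} (hp : ∀ g, p ≤ p.comap (ρ g)) {e : Module.End E V} (he : ∀ v, e v ∈ p)
    (he' : ∀ v ∈ p, e v = v) (hfin : (Set.range fun g => ρ g * e * ρ g⁻¹).Finite) :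
    ∃ e : Module.End E V, (∀ g, Commute (ρ g) e) ∧ (∀ v, e v ∈ p) ∧ ∀ v ∈ p, e v = v := by
  classical
  set S := hfin.toFinset with hS
  have hmem : ∀ s, s ∈ S ↔ ∃ g, ρ g * e * ρ g⁻¹ = s := by simp [hS]
  have hcard : (S.card : E) ≠ 0 := by
    rw [Nat.cast_ne_zero, Finset.card_ne_zero]
    exact ⟨_, (hmem _).2 ⟨1, rfl⟩⟩
  have hinv : ∀ g, ρ g * ρ g⁻¹ = 1 := fun g => by rw [← map_mul, mul_inv_cancel, map_one]
  have hinv' : ∀ g, ρ g⁻¹ * ρ g = 1 := fun g => by rw [← map_mul, inv_mul_cancel, map_one]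
  have hconj : ∀ g, ∀ s ∈ S, ρ g * s * ρ g⁻¹ ∈ S := by
    intro g s hs
    obtain ⟨h, rfl⟩ := (hmem s).1 hs
    exact (hmem _).2 ⟨g * h, by rw [mul_inv_rev, map_mul, map_mul]; simp only [mul_assoc]⟩
  refine ⟨(S.card : E)⁻¹ • ∑ s ∈ S, s, fun g => ?_, fun v => ?_, fun v hv => ?_⟩
  · refine Commute.smul_right ?_ _
    have h1 : ∑ s ∈ S, ρ g * s * ρ g⁻¹ = ∑ s ∈ S, s := by
      refine Finset.sum_bij' (fun s _ => ρ g * s * ρ g⁻¹) (fun s _ => ρ g⁻¹ * s * ρ g)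
        (fun s hs => hconj g s hs)
        (fun s hs => by simpa using hconj g⁻¹ s hs) ?_ ?_ (fun _ _ => rfl)
      · intro s _
        rw [← mul_assoc, ← mul_assoc, hinv', one_mul, mul_assoc, hinv', mul_one]
      · intro s _
        rw [← mul_assoc, ← mul_assoc, hinv, one_mul, mul_assoc, hinv, mul_one]
    rw [← Finset.sum_mul, ← Finset.mul_sum] at h1
    rw [Commute, SemiconjBy]
    conv_rhs => rw [← h1]
    rw [mul_assoc _ (ρ g⁻¹), hinv', mul_one]
  · rw [LinearMap.smul_apply, LinearMap.sum_apply]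
    refine p.smul_mem _ (p.sum_mem fun s hs => ?_)
    obtain ⟨g, rfl⟩ := (hmem s).1 hs
    exact hp g (he _)
  · rw [LinearMap.smul_apply, LinearMap.sum_apply]
    have h1 : ∀ s ∈ S, s v = v := by
      intro s hs
      obtain ⟨g, rfl⟩ := (hmem s).1 hs
      rw [Module.End.mul_apply, Module.End.mul_apply, he' _ (hp g⁻¹ hv),
        ← Module.End.mul_apply, hinv, Module.End.one_apply]
    rw [Finset.sum_congr rfl h1, Finset.sum_const, ← Nat.cast_smul_eq_nsmul E, smul_smul,
      inv_mul_cancel₀ hcard, one_smul]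

/-- A representation of a group `T ⟨φ⟩`, with `T` normal, is semisimple if `T` acts through a finite
quotient and `φ` acts semisimply: a power of `φ` commutes with the image of `T`, and a projection
commuting with that power has only finitely many conjugates. -/
theorem hasInvariantProjections_of_finite [CharZero E] [FiniteDimensional E V]
    (ρ : Representation E G V) (T : Subgroup G) [T.Normal] (φ : G)
    (hT : (ρ '' (T : Set G)).Finite) (hφ : Module.End.IsSemisimple (ρ φ))
    (hG : ∀ g : G, ∃ t ∈ T, ∃ k : ℤ, g = t * φ ^ k) : HasInvariantProjections ρ := by
  have hinv : ∀ g, ρ g * ρ g⁻¹ = 1 := fun g => by rw [← map_mul, mul_inv_cancel, map_one]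
  have hinv' : ∀ g, ρ g⁻¹ * ρ g = 1 := fun g => by rw [← map_mul, inv_mul_cancel, map_one]
  have : Finite (ρ '' (T : Set G)) := hT
  -- some positive power of `φ` commutes with the image of `T`
  obtain ⟨m, hm0, hm⟩ : ∃ m : ℕ, 0 < m ∧ ∀ t ∈ T, Commute (ρ (φ ^ m)) (ρ t) := by
    let c : ℕ → (ρ '' (T : Set G)) → (ρ '' (T : Set G)) := fun i s =>
      ⟨ρ (φ ^ i) * s.1 * ρ (φ ^ i)⁻¹, by
        obtain ⟨t, ht, h⟩ := s.2
        refine ⟨φ ^ i * t * (φ ^ i)⁻¹, Subgroup.Normal.conj_mem inferInstance t ht _, ?_⟩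
        rw [← h, map_mul, map_mul]⟩
    have key : ∀ i j : ℕ, i < j → c i = c j →
        ∃ m : ℕ, 0 < m ∧ ∀ t ∈ T, Commute (ρ (φ ^ m)) (ρ t) := by
      intro i j hij h
      obtain ⟨m, rfl⟩ := Nat.exists_eq_add_of_lt hij
      refine ⟨m + 1, Nat.succ_pos _, fun t ht => ?_⟩
      have h1 : ρ (φ ^ i) * ρ t * ρ (φ ^ i)⁻¹ =
          ρ (φ ^ (i + m + 1)) * ρ t * ρ (φ ^ (i + m + 1))⁻¹ :=
        congrArg Subtype.val (congrFun h ⟨ρ t, t, ht, rfl⟩)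
      have h2 : ρ t = ρ (φ ^ (m + 1)) * ρ t * ρ (φ ^ (m + 1))⁻¹ := by
        have h3 := congrArg (fun z => ρ (φ ^ i)⁻¹ * z * ρ (φ ^ i)) h1
        simp only [← map_mul] at h3 ⊢
        convert h3 using 2
        · group
        · rw [add_assoc, pow_add φ i]; group
      rw [Commute, SemiconjBy]
      conv_rhs => rw [h2]
      rw [mul_assoc _ (ρ (φ ^ (m + 1))⁻¹), hinv', mul_one]
    obtain ⟨i, j, hne, h⟩ := Finite.exists_ne_map_eq_of_infinite c
    rcases lt_or_gt_of_ne hne with hij | hij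
    · exact key i j hij h
    · exact key j i hij h.symm
  intro p hp
  have hss : Module.End.IsSemisimple (ρ (φ ^ m)) := by
    rw [map_pow]; exact hφ.pow m
  obtain ⟨q, hq, hpq⟩ := Module.End.isSemisimple_iff.1 hss p (hp _)
  have hcomm : Commute (ρ (φ ^ m)) (p.projection q hpq) := by
    ext v
    have h1 := hp (φ ^ m) (Submodule.projection_apply_mem hpq v)
    have h2 := hq (Submodule.sub_projection_mem hpq v)
    rw [Submodule.mem_comap] at h1 h2
    have h3 := congrArg (p.projection q hpq)
      (map_add (ρ (φ ^ m)) (p.projection q hpq v) (v - p.projection q hpq v))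
    rw [add_sub_cancel, map_add, Submodule.projection_apply_of_mem_left hpq h1,
      (Submodule.projection_apply_eq_zero_iff hpq).2 h2, add_zero] at h3
    exact h3.symm
  refine exists_invariant_projection_of_finite ρ hp (e := p.projection q hpq)
    (fun v => Submodule.projection_apply_mem hpq v) (fun v hv => ?_) ?_
  · exact Submodule.projection_apply_left hpq ⟨v, hv⟩
  · set e := p.projection q hpq with he
    have hfin : (Set.image2 (fun (s : Module.End E V × Module.End E V) (r : ℕ) =>
        s.1 * (ρ (φ ^ r) * e * ρ (φ ^ r)⁻¹) * s.2)
        ((ρ '' (T : Set G)) ×ˢ (ρ '' (T : Set G))) (Set.Iio m)).Finite :=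
      Set.Finite.image2 _ (hT.prod hT) (Set.finite_Iio m)
    refine hfin.subset ?_
    rintro _ ⟨g, rfl⟩
    obtain ⟨t, ht, k, rfl⟩ := hG g
    have hm' : (m : ℤ) ≠ 0 := by exact_mod_cast hm0.ne'
    obtain ⟨r, hr⟩ := Int.eq_ofNat_of_zero_le (Int.emod_nonneg k hm')
    have hrm : r < m := by
      have := Int.emod_lt_of_pos k (Int.natCast_pos.2 hm0)
      omega
    have hk : φ ^ k = φ ^ r * (φ ^ m) ^ (k / m) := by
      rw [← zpow_natCast φ r, ← hr, ← zpow_natCast φ m, ← zpow_mul, ← zpow_add,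
        Int.emod_add_mul_ediv]
    -- the conjugate by `t φ ^ k` depends only on `ρ t` and on `k` modulo `m`
    have hz : ρ ((φ ^ m) ^ (k / m)) * e * ρ ((φ ^ m) ^ (k / m))⁻¹ = e := by
      have h1 : Commute e (ρ ((φ ^ m) ^ (k / m))) := by
        have h2 : Commute e
            ((MonoidHom.toHomUnits ρ (φ ^ m) : (Module.End E V)ˣ) : Module.End E V) :=
          hcomm.symm
        have h3 := h2.units_zpow_right (k / m)
        rwa [← map_zpow] at h3
      rw [← h1.eq, mul_assoc, hinv, mul_one]
    refine ⟨(ρ t, ρ t⁻¹), ⟨⟨t, ht, rfl⟩, ⟨t⁻¹, T.inv_mem ht, rfl⟩⟩, r, hrm, ?_⟩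
    dsimp only
    rw [hk]
    conv_lhs => rw [← hz]
    simp only [mul_inv_rev, map_mul, mul_assoc]

end Projections

/-! ### Semisimple representations and their traces -/

section BrauerNesbitt

variable {E A : Type*} [Field E] [Ring A] [Algebra E A]

theorem linearMap_eq_zero_of_forall_eq_zero {M M' : Type*} [AddCommGroup M] [Module A M]
    [AddCommGroup M'] [Module A M'] [IsSemisimpleModule A M] [IsSemisimpleModule A M']
    (h : ∀ f : M →ₗ[A] M', f = 0) (g : M' →ₗ[A] M) : g = 0 := by
  obtain ⟨s, hs⟩ := IsSemisimpleModule.lifting_property g.rangeRestrict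
    g.surjective_rangeRestrict LinearMap.id
  obtain ⟨t, ht⟩ := IsSemisimpleModule.extension_property (LinearMap.range g).subtype
    (Submodule.subtype_injective _) s
  rw [h t, LinearMap.zero_comp] at ht
  rw [← ht, LinearMap.comp_zero] at hs
  ext x
  have := LinearMap.congr_fun hs (g.rangeRestrict x)
  simpa using (congrArg Subtype.val this).symm

/-- If there are no nonzero maps between the semisimple modules `M` and `M'`, the density theorem
gives an element of `A` acting as the identity on `M` and as zero on `M'`. -/
theorem exists_smul_eq_self_and_smul_eq_zero {M M' : Type*} [AddCommGroup M] [Module E M]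
    [Module A M] [IsScalarTower E A M] [FiniteDimensional E M] [IsSemisimpleModule A M]
    [AddCommGroup M'] [Module E M'] [Module A M'] [IsScalarTower E A M'] [FiniteDimensional E M']
    [IsSemisimpleModule A M'] (h : ∀ f : M →ₗ[A] M', f = 0) :
    ∃ a : A, (∀ x : M, a • x = x) ∧ ∀ x : M', a • x = 0 := by
  have h' := linearMap_eq_zero_of_forall_eq_zero h
  let F : Module.End (Module.End A (M × M')) (M × M') :=
    { toFun := fun x => (x.1, 0)
      map_add' := fun x y => by simp
      map_smul' := fun φ x => by
        have e1 : (φ (x.1, 0)).2 = 0 :=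
          LinearMap.congr_fun (h (LinearMap.snd A M M' ∘ₗ φ ∘ₗ LinearMap.inl A M M')) x.1
        have e2 : (φ (0, x.2)).1 = 0 :=
          LinearMap.congr_fun (h' (LinearMap.fst A M M' ∘ₗ φ ∘ₗ LinearMap.inr A M M')) x.2
        have e3 : φ x = φ (x.1, 0) + φ (0, x.2) := by rw [← map_add]; simp
        simp only [Module.End.smul_def, RingHom.id_apply]
        rw [e3]
        ext <;> simp [e1, e2] }
  have : IsSemisimpleModule A (M × M') := by
    have h1 : IsSemisimpleModule A (LinearMap.range (LinearMap.inl A M M')) :=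
      IsSemisimpleModule.range _
    have h2 : IsSemisimpleModule A (LinearMap.range (LinearMap.inr A M M')) :=
      IsSemisimpleModule.range _
    have h3 := IsSemisimpleModule.sup h1 h2
    rw [LinearMap.sup_range_inl_inr] at h3
    exact IsSemisimpleModule.congr Submodule.topEquiv.symm
  obtain ⟨s, hs⟩ := (Module.Finite.fg_top : (⊤ : Submodule E (M × M')).FG)
  obtain ⟨r, hr⟩ := jacobson_density F s
  have key : ∀ x : M × M', (x.1, (0 : M')) = r • x := by
    intro x
    have hx : x ∈ Submodule.span E (s : Set (M × M')) := hs ▸ Submodule.mem_top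
    induction hx using Submodule.span_induction with
    | mem x hx => exact hr x hx
    | zero => simp
    | add x y _ _ hx hy => rw [smul_add, ← hx, ← hy]; simp
    | smul c x _ hx => rw [smul_comm, ← hx]; simp
  exact ⟨r, fun x => (congrArg Prod.fst (key (x, 0))).symm,
    fun x => (congrArg Prod.snd (key (0, x))).symm⟩

theorem trace_lsmul_congr {M M' : Type*} [AddCommGroup M] [Module E M] [Module A M]
    [IsScalarTower E A M] [AddCommGroup M'] [Module E M'] [Module A M'] [IsScalarTower E A M']
    (e : M ≃ₗ[A] M') (a : A) :
    LinearMap.trace E M (Algebra.lsmul E E M a) =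
      LinearMap.trace E M' (Algebra.lsmul E E M' a) := by
  rw [← LinearMap.trace_conj' _ (e.restrictScalars E)]
  congr 1
  ext x
  simp [LinearEquiv.conj_apply]

theorem trace_lsmul_prod {M M' : Type*} [AddCommGroup M] [Module E M] [Module A M]
    [IsScalarTower E A M] [AddCommGroup M'] [Module E M'] [Module A M'] [IsScalarTower E A M']
    [FiniteDimensional E M] [FiniteDimensional E M'] (a : A) :
    LinearMap.trace E (M × M') (Algebra.lsmul E E (M × M') a) =
      LinearMap.trace E M (Algebra.lsmul E E M a) +
        LinearMap.trace E M' (Algebra.lsmul E E M' a) := by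
  rw [← LinearMap.trace_prodMap']
  rfl

/-- In characteristic zero, semisimple modules are determined by their traces: a nonzero map between
them gives a common summand to cancel, and if there is none both modules are zero. -/
theorem nonempty_linearEquiv_of_trace_eq [CharZero E] {M M' : Type*} [AddCommGroup M] [Module E M]
    [Module A M] [IsScalarTower E A M] [FiniteDimensional E M] [IsSemisimpleModule A M]
    [AddCommGroup M'] [Module E M'] [Module A M'] [IsScalarTower E A M'] [FiniteDimensional E M']
    [IsSemisimpleModule A M']
    (htr : ∀ a : A, LinearMap.trace E M (Algebra.lsmul E E M a) =
      LinearMap.trace E M' (Algebra.lsmul E E M' a)) : Nonempty (M ≃ₗ[A] M') := by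
  induction hn : Module.finrank E M using Nat.strong_induction_on generalizing M M' with
  | _ n ih =>
  by_cases h : ∀ f : M →ₗ[A] M', f = 0
  · obtain ⟨a, ha, ha'⟩ := exists_smul_eq_self_and_smul_eq_zero (E := E) h
    have e1 : Algebra.lsmul E E M a = 1 := LinearMap.ext ha
    have e2 : Algebra.lsmul E E M' a = 0 := LinearMap.ext ha'
    have h1 := htr a
    rw [e1, e2, LinearMap.trace_one E M, map_zero, Nat.cast_eq_zero] at h1
    have h2 := htr 1
    rw [map_one (Algebra.lsmul E E M), map_one (Algebra.lsmul E E M'), LinearMap.trace_one E M,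
      LinearMap.trace_one E M', h1, Nat.cast_inj] at h2
    have := Module.finrank_zero_iff.1 h1
    have := Module.finrank_zero_iff.1 h2.symm
    exact ⟨{ (0 : M →ₗ[A] M') with
      invFun := 0
      left_inv := fun _ => Subsingleton.elim _ _
      right_inv := fun _ => Subsingleton.elim _ _ }⟩
  · push Not at h
    obtain ⟨f, hf⟩ := h
    obtain ⟨C, hC⟩ := exists_isCompl (LinearMap.ker f)
    obtain ⟨C', hC'⟩ := exists_isCompl (LinearMap.range f)
    let e : M ≃ₗ[A] LinearMap.ker f × LinearMap.range f :=
      (Submodule.prodEquivOfIsCompl _ _ hC).symm.trans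
        ((LinearEquiv.refl A _).prodCongr (f.kerComplementEquivRange hC.symm))
    let e' : M' ≃ₗ[A] C' × LinearMap.range f := (Submodule.prodEquivOfIsCompl _ _ hC'.symm).symm
    have fin1 : FiniteDimensional E (LinearMap.ker f) :=
      Module.Finite.of_injective ((LinearMap.ker f).subtype.restrictScalars E) Subtype.val_injective
    have fin2 : FiniteDimensional E (LinearMap.range f) :=
      Module.Finite.of_injective ((LinearMap.range f).subtype.restrictScalars E)
        Subtype.val_injective
    have fin3 : FiniteDimensional E C' :=
      Module.Finite.of_injective (C'.subtype.restrictScalars E) Subtype.val_injective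
    have hlt : Module.finrank E (LinearMap.ker f) < n := by
      rw [← hn]
      refine Submodule.finrank_lt (K := E) (s := (LinearMap.ker f).restrictScalars E) ?_
      intro h0
      apply hf
      ext x
      have : x ∈ (LinearMap.ker f).restrictScalars E := h0 ▸ Submodule.mem_top
      exact this
    obtain ⟨u⟩ := ih _ hlt (M := LinearMap.ker f) (M' := C') (fun a => by
      have h1 := htr a
      rw [trace_lsmul_congr e a, trace_lsmul_congr e' a, trace_lsmul_prod, trace_lsmul_prod] at h1
      exact add_right_cancel h1) rfl
    exact ⟨e.trans ((u.prodCongr (LinearEquiv.refl A _)).trans e'.symm)⟩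

end BrauerNesbitt

section Representation

variable {E G V V' : Type*} [Field E] [Group G] [AddCommGroup V] [Module E V]
  [AddCommGroup V'] [Module E V']

theorem HasInvariantProjections.isSemisimpleModule {ρ : Representation E G V}
    (h : HasInvariantProjections ρ) : IsSemisimpleModule (MonoidAlgebra E G) ρ.asModule := by
  rw [← Representation.isSemisimpleRepresentation_iff_isSemisimpleModule_asModule]
  refine ⟨fun p => ?_⟩
  obtain ⟨e, hcomm, hmem, hid⟩ := h p.toSubmodule (fun g v hv => p.apply_mem_toSubmodule g hv)
  refine ⟨⟨LinearMap.ker e, fun g v hv => ?_⟩, ?_⟩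
  · have := LinearMap.congr_fun (hcomm g).eq v
    simp only [Module.End.mul_apply] at this
    rw [LinearMap.mem_ker, ← this, LinearMap.mem_ker.1 hv, map_zero]
  · constructor
    · rw [disjoint_iff_inf_le]
      rintro v ⟨hv, hv'⟩
      have h1 : e v = v := hid v hv
      rw [LinearMap.mem_ker.1 hv'] at h1
      exact h1.symm
    · rw [codisjoint_iff_le_sup]
      rintro v -
      refine Submodule.mem_sup.2 ⟨e v, hmem v, v - e v, ?_, by simp⟩
      change e (v - e v) = 0
      rw [map_sub, hid _ (hmem v), sub_self]

theorem trace_lsmul_asModule [FiniteDimensional E V] [FiniteDimensional E V']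
    {ρ : Representation E G V} {ρ' : Representation E G V'}
    (h : ∀ g, LinearMap.trace E V (ρ g) = LinearMap.trace E V' (ρ' g)) (a : MonoidAlgebra E G) :
    LinearMap.trace E ρ.asModule (Algebra.lsmul E E ρ.asModule a) =
      LinearMap.trace E ρ'.asModule (Algebra.lsmul E E ρ'.asModule a) := by
  induction a using MonoidAlgebra.induction_linear with
  | zero => rw [map_zero, map_zero, map_zero, map_zero]
  | add x y hx hy => rw [map_add, map_add, map_add, map_add, hx, hy]
  | single g c =>
    have e1 : Algebra.lsmul E E ρ.asModule (MonoidAlgebra.single g c) = c • ρ g :=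
      LinearMap.ext fun v => Representation.single_smul ρ c g v
    have e2 : Algebra.lsmul E E ρ'.asModule (MonoidAlgebra.single g c) = c • ρ' g :=
      LinearMap.ext fun v => Representation.single_smul ρ' c g v
    rw [e1, e2]
    change LinearMap.trace E V (c • ρ g) = LinearMap.trace E V' (c • ρ' g)
    rw [map_smul, map_smul, h]

/-- In characteristic zero, semisimple representations are determined by their characters. -/
theorem exists_equiv_of_trace_eq [CharZero E] [FiniteDimensional E V] [FiniteDimensional E V']
    {ρ : Representation E G V} {ρ' : Representation E G V'}
    (hρ : HasInvariantProjections ρ) (hρ' : HasInvariantProjections ρ')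
    (h : ∀ g, LinearMap.trace E V (ρ g) = LinearMap.trace E V' (ρ' g)) :
    ∃ e : V ≃ₗ[E] V', ∀ g v, e (ρ g v) = ρ' g (e v) := by
  have := hρ.isSemisimpleModule
  have := hρ'.isSemisimpleModule
  have : FiniteDimensional E ρ.asModule := inferInstanceAs (FiniteDimensional E V)
  have : FiniteDimensional E ρ'.asModule := inferInstanceAs (FiniteDimensional E V')
  obtain ⟨e⟩ := nonempty_linearEquiv_of_trace_eq (trace_lsmul_asModule h)
  refine ⟨ρ.asModuleEquiv.symm.trans ((e.restrictScalars E).trans ρ'.asModuleEquiv), fun g v => ?_⟩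
  change ρ'.asModuleEquiv (e (ρ.asModuleEquiv.symm (ρ g v))) =
    ρ' g (ρ'.asModuleEquiv (e (ρ.asModuleEquiv.symm v)))
  rw [Representation.asModuleEquiv_symm_map_rho, map_smul, Representation.asModuleEquiv_map_smul,
    MonoidAlgebra.of_apply, Representation.asAlgebraHom_single_one]

end Representation

/-! ### Extending maps from the kernel of the monodromy operator -/

section Extension

variable {E G V V' : Type*} [Field E] [Group G] [AddCommGroup V] [Module E V]
  [AddCommGroup V'] [Module E V']

theorem exists_linearMap_eq_on_sup {A B : Submodule E V} {f g : V →ₗ[E] V'}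
    (h : ∀ v ∈ A, v ∈ B → f v = g v) :
    ∃ u : V →ₗ[E] V', (∀ v ∈ A, u v = f v) ∧ ∀ v ∈ B, u v = g v := by
  obtain ⟨P, hA, hB⟩ : ∃ P : V →ₗ.[E] V', (⟨A, f.domRestrict A⟩ : V →ₗ.[E] V') ≤ P ∧
      (⟨B, g.domRestrict B⟩ : V →ₗ.[E] V') ≤ P :=
    have hAB : ∀ (x : A) (y : B), (x : V) = y → f.domRestrict A x = g.domRestrict B y := by
      rintro ⟨x, hx⟩ ⟨y, hy⟩ hxy
      obtain rfl : x = y := hxy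
      exact h x hx hy
    ⟨_, LinearPMap.left_le_sup _ _ hAB, LinearPMap.right_le_sup _ _ hAB⟩
  obtain ⟨u, hu⟩ := P.toFun.exists_extend
  refine ⟨u, fun v hv => ?_, fun v hv => ?_⟩
  · exact (LinearMap.congr_fun hu ⟨v, hA.1 hv⟩).trans
      (hA.2 (x := ⟨v, hv⟩) (y := ⟨v, hA.1 hv⟩) rfl).symm
  · exact (LinearMap.congr_fun hu ⟨v, hB.1 hv⟩).trans
      (hB.2 (x := ⟨v, hv⟩) (y := ⟨v, hB.1 hv⟩) rfl).symm

theorem exists_apply_apply_eq_self_of_mem_range (M : Module.End E V) :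
    ∃ t : Module.End E V, ∀ y ∈ LinearMap.range M, M (t y) = y := by
  obtain ⟨s, hs⟩ := M.rangeRestrict.exists_rightInverse_of_surjective M.range_rangeRestrict
  obtain ⟨t, ht⟩ := s.exists_extend
  refine ⟨t, fun y hy => ?_⟩
  have h1 : t y = s ⟨y, hy⟩ := LinearMap.congr_fun ht ⟨y, hy⟩
  rw [h1]
  exact congrArg Subtype.val (LinearMap.congr_fun hs ⟨y, hy⟩)

variable {ρ : Representation E G V} {ρ' : Representation E G V'} {N : Module.End E V}
  {N' : Module.End E V'} {c : G → E}

theorem pow_apply_mem_range_of_mem_range (M : Module.End E V) {k : ℕ} {v : V}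
    (hv : v ∈ LinearMap.range (M ^ k)) : M v ∈ LinearMap.range (M ^ (k + 1)) := by
  obtain ⟨z, rfl⟩ := hv
  exact ⟨z, by rw [pow_succ', Module.End.mul_apply]⟩

theorem mem_range_pow_of_mem_range_pow_succ (M : Module.End E V) {k : ℕ} {v : V}
    (hv : v ∈ LinearMap.range (M ^ (k + 1))) : v ∈ LinearMap.range (M ^ k) := by
  obtain ⟨z, rfl⟩ := hv
  exact ⟨M z, by rw [pow_succ, Module.End.mul_apply]⟩

theorem range_pow_le_comap_of_semiconj (hN : ∀ g v, ρ g (N v) = c g • N (ρ g v)) (k : ℕ) (g : G) :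
    LinearMap.range (N ^ k) ≤ (LinearMap.range (N ^ k)).comap (ρ g) := by
  rintro _ ⟨v, rfl⟩
  rw [Submodule.mem_comap]
  induction k generalizing v with
  | zero => exact ⟨ρ g v, by simp⟩
  | succ k ih =>
    have e : (N ^ (k + 1)) v = N ((N ^ k) v) := by rw [pow_succ', Module.End.mul_apply]
    rw [e, hN]
    exact Submodule.smul_mem _ _ (pow_apply_mem_range_of_mem_range N (ih v))

/-- One step of the extension of an intertwining map on `ker N`: a map on `im N ^ (k + 1)` is
extended to `im N ^ k`. -/
theorem exists_extension_step (hρ : HasInvariantProjections ρ) (hρ' : HasInvariantProjections ρ')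
    (hc : ∀ g, c g ≠ 0) (hN : ∀ g v, ρ g (N v) = c g • N (ρ g v))
    (hN' : ∀ g v, ρ' g (N' v) = c g • N' (ρ' g v)) (f : V →ₗ[E] V')
    (hf : ∀ g v, N v = 0 → f (ρ g v) = ρ' g (f v)) (hf0 : ∀ v, N v = 0 → N' (f v) = 0) (k : ℕ)
    (hfk : ∀ v ∈ LinearMap.range (N ^ k), N v = 0 → f v ∈ LinearMap.range (N' ^ k))
    (h : V →ₗ[E] V')
    (h1 : ∀ g, ∀ v ∈ LinearMap.range (N ^ (k + 1)), h (ρ g v) = ρ' g (h v))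
    (h2 : ∀ v ∈ LinearMap.range (N ^ (k + 1)), h v ∈ LinearMap.range (N' ^ (k + 1)))
    (h3 : ∀ v ∈ LinearMap.range (N ^ (k + 1)), h (N v) = N' (h v))
    (h4 : ∀ v ∈ LinearMap.range (N ^ (k + 1)), N v = 0 → h v = f v) :
    ∃ h : V →ₗ[E] V', (∀ g, ∀ v ∈ LinearMap.range (N ^ k), h (ρ g v) = ρ' g (h v)) ∧
      (∀ v ∈ LinearMap.range (N ^ k), h v ∈ LinearMap.range (N' ^ k)) ∧
      (∀ v ∈ LinearMap.range (N ^ k), h (N v) = N' (h v)) ∧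
      ∀ v ∈ LinearMap.range (N ^ k), N v = 0 → h v = f v := by
  have stab := range_pow_le_comap_of_semiconj hN
  have stab' := range_pow_le_comap_of_semiconj hN'
  have kerstab : ∀ g v, N v = 0 → N (ρ g v) = 0 := fun g v hv => by
    have := hN g v
    rw [hv, map_zero] at this
    exact (smul_eq_zero.1 this.symm).resolve_left (hc g)
  have kerstab' : ∀ g v, N' v = 0 → N' (ρ' g v) = 0 := fun g v hv => by
    have := hN' g v
    rw [hv, map_zero] at this
    exact (smul_eq_zero.1 this.symm).resolve_left (hc g)
  set R := LinearMap.range (N ^ k) with hR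
  set R1 := LinearMap.range (N ^ (k + 1)) with hR1
  set R' := LinearMap.range (N' ^ k) with hR'
  set A := LinearMap.ker N ⊓ R with hA
  -- `u` is the common extension of `f` and `h` to `(ker N ∩ im N ^ k) + im N ^ (k + 1)`
  obtain ⟨u, huA, huR⟩ : ∃ u : V →ₗ[E] V', (∀ v ∈ A, u v = f v) ∧ ∀ v ∈ R1, u v = h v :=
    exists_linearMap_eq_on_sup fun v hv hv' => (h4 v hv' hv.1).symm
  have hA_stab : ∀ g, A ≤ A.comap (ρ g) := fun g v hv => ⟨kerstab g v hv.1, stab k g hv.2⟩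
  obtain ⟨e, he, heT, heid⟩ := hρ (A ⊔ R1) fun g => sup_le
    ((hA_stab g).trans (Submodule.comap_mono le_sup_left))
    ((stab (k + 1) g).trans (Submodule.comap_mono le_sup_right))
  obtain ⟨e', he', heA', heid'⟩ := hρ' (LinearMap.ker N' ⊓ R') fun g v hv =>
    ⟨kerstab' g v hv.1, stab' k g hv.2⟩
  obtain ⟨t, ht⟩ := exists_apply_apply_eq_self_of_mem_range (N' ^ (k + 1))
  -- `l` is an equivariant lift of `h ∘ N` through `N'` on `im N ^ k`
  let l : V →ₗ[E] V' := (1 - e') ∘ₗ (N' ^ k) ∘ₗ t ∘ₗ h ∘ₗ N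
  have hl : ∀ v, l v = (N' ^ k) (t (h (N v))) - e' ((N' ^ k) (t (h (N v)))) := fun v => rfl
  have hlR : ∀ v, l v ∈ R' := fun v => by
    rw [hl]
    exact sub_mem ⟨_, rfl⟩ (heA' _).2
  have hlN : ∀ v ∈ R, N' (l v) = h (N v) := fun v hv => by
    have e1 : N' (e' ((N' ^ k) (t (h (N v))))) = 0 := (heA' _).1
    rw [hl, map_sub, e1, sub_zero, ← Module.End.mul_apply, ← pow_succ']
    exact ht _ (h2 _ (pow_apply_mem_range_of_mem_range N hv))
  have hle : ∀ v, e' (l v) = 0 := fun v => by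
    rw [hl, map_sub, heid' _ (heA' _), sub_self]
  have hlρ : ∀ g, ∀ v ∈ R, l (ρ g v) = ρ' g (l v) := fun g v hv => by
    have e1 : N' (l (ρ g v) - ρ' g (l v)) = 0 := by
      apply smul_right_injective V' (hc g)
      dsimp only
      have hNv := pow_apply_mem_range_of_mem_range N hv
      rw [smul_zero, map_sub, hlN _ (stab k g hv), smul_sub, ← hN', hlN v hv, ← map_smul, ← hN,
        h1 g _ hNv, sub_self]
    have e2 : e' (ρ' g (l v)) = 0 := by
      have := LinearMap.congr_fun (he' g).eq (l v)
      simp only [Module.End.mul_apply] at this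
      rw [← this, hle, map_zero]
    have e3 := heid' (l (ρ g v) - ρ' g (l v)) ⟨e1, sub_mem (hlR _) (stab' k g (hlR _))⟩
    rw [map_sub, hle, e2, sub_zero] at e3
    exact sub_eq_zero.1 e3.symm
  have hTR : A ⊔ R1 ≤ R := sup_le inf_le_right fun v hv => mem_range_pow_of_mem_range_pow_succ N hv
  have hN1 : ∀ v ∈ R, N v ∈ R1 := fun v hv => pow_apply_mem_range_of_mem_range N hv
  have huρ : ∀ g, ∀ v ∈ A ⊔ R1, u (ρ g v) = ρ' g (u v) := by
    intro g v hv
    obtain ⟨a, ha, b, hb, rfl⟩ := Submodule.mem_sup.1 hv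
    rw [map_add, map_add, map_add, map_add, huA _ ha, huR _ hb, huA _ (hA_stab g ha),
      huR _ (stab (k + 1) g hb), h1 g b hb, hf g a ha.1]
  have huR' : ∀ v ∈ A ⊔ R1, u v ∈ R' := by
    intro v hv
    obtain ⟨a, ha, b, hb, rfl⟩ := Submodule.mem_sup.1 hv
    rw [map_add, huA _ ha, huR _ hb]
    exact add_mem (hfk a ha.2 ha.1) (mem_range_pow_of_mem_range_pow_succ N' (h2 b hb))
  have huN : ∀ v ∈ A ⊔ R1, N' (u v) = h (N v) := by
    intro v hv
    obtain ⟨a, ha, b, hb, rfl⟩ := Submodule.mem_sup.1 hv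
    have ha0 : N a = 0 := ha.1
    rw [map_add, huA _ ha, huR _ hb, map_add, hf0 a ha0, map_add, ha0, zero_add, zero_add, h3 b hb]
  have hsub : ∀ v ∈ R, v - e v ∈ R := fun v hv => sub_mem hv (hTR (heT v))
  have hval : ∀ v, (l ∘ₗ (1 - e) + u ∘ₗ e : V →ₗ[E] V') v = l (v - e v) + u (e v) := fun v => rfl
  have hvalT : ∀ v ∈ A ⊔ R1, (l ∘ₗ (1 - e) + u ∘ₗ e : V →ₗ[E] V') v = u v := fun v hv => by
    rw [hval, heid v hv, sub_self, map_zero, zero_add]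
  refine ⟨l ∘ₗ (1 - e) + u ∘ₗ e, fun g v hv => ?_, fun v hv => ?_, fun v hv => ?_,
    fun v hv hv0 => ?_⟩
  · have e1 : e (ρ g v) = ρ g (e v) := (LinearMap.congr_fun (he g).eq v).symm
    rw [hval, hval, e1, ← map_sub (ρ g), hlρ g _ (hsub v hv), huρ g _ (heT v), map_add]
  · rw [hval]
    exact add_mem (hlR _) (huR' _ (heT v))
  · rw [hvalT _ ((le_sup_right : R1 ≤ A ⊔ R1) (hN1 v hv)), huR _ (hN1 v hv), hval, map_add,
      hlN _ (hsub v hv), huN _ (heT v), ← map_add h, ← map_add N, sub_add_cancel]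
  · rw [hvalT _ ((le_sup_left : A ≤ A ⊔ R1) ⟨hv0, hv⟩), huA _ ⟨hv0, hv⟩]

/-- An injective intertwining map `ker N → ker N'` carrying `ker N ∩ im N ^ k` into `im N' ^ k` for
all `k` extends to an injective map of representations with monodromy operators. -/
theorem exists_extension (hρ : HasInvariantProjections ρ) (hρ' : HasInvariantProjections ρ')
    (hc : ∀ g, c g ≠ 0) (hN : ∀ g v, ρ g (N v) = c g • N (ρ g v))
    (hN' : ∀ g v, ρ' g (N' v) = c g • N' (ρ' g v)) (hnil : IsNilpotent N) (f : V →ₗ[E] V')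
    (hf : ∀ g v, N v = 0 → f (ρ g v) = ρ' g (f v)) (hf0 : ∀ v, N v = 0 → N' (f v) = 0)
    (hfk : ∀ k, ∀ v ∈ LinearMap.range (N ^ k), N v = 0 → f v ∈ LinearMap.range (N' ^ k))
    (hinj : ∀ v, N v = 0 → f v = 0 → v = 0) :
    ∃ h : V →ₗ[E] V', Function.Injective h ∧ (∀ g v, h (ρ g v) = ρ' g (h v)) ∧
      ∀ v, h (N v) = N' (h v) := by
  obtain ⟨n, hn⟩ := hnil
  have key : ∀ k ≤ n, ∃ h : V →ₗ[E] V',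
      (∀ g, ∀ v ∈ LinearMap.range (N ^ k), h (ρ g v) = ρ' g (h v)) ∧
      (∀ v ∈ LinearMap.range (N ^ k), h v ∈ LinearMap.range (N' ^ k)) ∧
      (∀ v ∈ LinearMap.range (N ^ k), h (N v) = N' (h v)) ∧
      ∀ v ∈ LinearMap.range (N ^ k), N v = 0 → h v = f v := by
    intro k hk
    induction hk using Nat.decreasingInduction with
    | self =>
      have hz : ∀ v ∈ LinearMap.range (N ^ n), v = 0 := by
        rintro _ ⟨v, rfl⟩
        rw [hn, LinearMap.zero_apply]
      exact ⟨0, by simp, by simp, by simp, fun v hv _ => by rw [hz v hv, map_zero, map_zero]⟩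
    | of_succ k _ ih =>
      obtain ⟨h, h1, h2, h3, h4⟩ := ih
      exact exists_extension_step hρ hρ' hc hN hN' f hf hf0 k (hfk k) h h1 h2 h3 h4
  obtain ⟨h, h1, -, h3, h4⟩ := key 0 (Nat.zero_le n)
  have htop : ∀ v, v ∈ LinearMap.range (N ^ 0) := fun v => ⟨v, by simp⟩
  refine ⟨h, ?_, fun g v => h1 g v (htop v), fun v => h3 v (htop v)⟩
  rw [injective_iff_map_eq_zero]
  have hker : ∀ m v, (N ^ m) v = 0 → h v = 0 → v = 0 := by
    intro m
    induction m with
    | zero => intro v hv _; simpa using hv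
    | succ m ih =>
      intro v hv hv'
      have hNv : N v = 0 := by
        apply ih
        · rwa [pow_succ, Module.End.mul_apply] at hv
        · rw [h3 v (htop v), hv', map_zero]
      exact hinj v hNv (by rw [← h4 v (htop v) hNv, hv'])
  exact fun v hv => hker n v (by rw [hn, LinearMap.zero_apply]) hv

end Extension

/-! ### Weights and the filtration of `ker N` -/

section Weights

open Polynomial

theorem IsWeilNumber.eq_abs {F : Type*} [Field F] [CharZero F] {α : F} {r s : ℝ}
    (hr : IsWeilNumber α r) (hs : IsWeilNumber α s) : r = s := by
  have hint : IsIntegral ℚ α := hr.1.isIntegral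
  obtain ⟨z, hz⟩ := IsAlgClosed.exists_aeval_eq_zero ℂ (minpoly ℚ α)
    (minpoly.degree_pos hint).ne'
  rw [← hr.2 z hz, ← hs.2 z hz]

/-- The Cayley–Hamilton theorem for an endomorphism of a subquotient `A / (A ∩ B)`. -/
theorem aeval_charpoly_quotient_mem {E X : Type*} [Field E] [AddCommGroup X] [Module E X]
    [FiniteDimensional E X] (T : Module.End E X) {A B : Submodule E X} (hA : A ≤ A.comap T)
    (Q : Module.End E (A ⧸ B.comap A.subtype))
    (hQ : ∀ v : A, Q (Submodule.Quotient.mk v) = Submodule.Quotient.mk ⟨T v, hA v.2⟩)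
    {v : X} (hv : v ∈ A) : aeval T Q.charpoly v ∈ B := by
  have key : ∀ p : E[X], ∃ h : aeval T p v ∈ A,
      aeval Q p (Submodule.Quotient.mk ⟨v, hv⟩) = Submodule.Quotient.mk ⟨aeval T p v, h⟩ := by
    intro p
    induction p using Polynomial.induction_on' with
    | add p q hp hq =>
      obtain ⟨h1, e1⟩ := hp
      obtain ⟨h2, e2⟩ := hq
      refine ⟨by rw [map_add]; exact add_mem h1 h2, ?_⟩
      simp only [map_add, LinearMap.add_apply]
      rw [e1, e2, ← Submodule.Quotient.mk_add]
      rfl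
    | monomial n c =>
      induction n with
      | zero =>
        refine ⟨by simpa using A.smul_mem c hv, ?_⟩
        simp only [monomial_zero_left, aeval_C, Module.algebraMap_end_apply]
        rw [← Submodule.Quotient.mk_smul]
        rfl
      | succ n ih =>
        obtain ⟨h1, e1⟩ := ih
        have e2 : ∀ {Y : Type _} [AddCommGroup Y] [Module E Y] (S : Module.End E Y) (y : Y),
            aeval S (monomial (n + 1) c) y = S (aeval S (monomial n c) y) := by
          intro Y _ _ S y
          simp [aeval_monomial, pow_succ']
        have e3 : aeval T (monomial (n + 1) c) v = T (aeval T (monomial n c) v) := by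
          simp [aeval_monomial, pow_succ']
        refine ⟨by rw [e3]; exact hA h1, ?_⟩
        rw [e2, e1, hQ]
        congr 1
        exact Subtype.ext e3.symm
  obtain ⟨h, e⟩ := key Q.charpoly
  rw [LinearMap.aeval_self_charpoly, LinearMap.zero_apply, eq_comm,
    Submodule.Quotient.mk_eq_zero] at e
  exact e

namespace WeilDeligneRep

variable {K E V V' : Type*} [Field K] [ValuativeRel K] [TopologicalSpace K]
  [IsNonarchimedeanLocalField K] [Field E] [CharZero E]
  [AddCommGroup V] [Module E V] [AddCommGroup V'] [Module E V']

theorem aeval_mem_kerFil (ρ : WeilDeligneRep K E V) (k : ℕ) (w : weilGroup K) (p : E[X])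
    {v : LinearMap.ker ρ.N} (hv : v ∈ ρ.kerFil k) : aeval (ρ.kerN w) p v ∈ ρ.kerFil k := by
  have hpow : ∀ i : ℕ, (ρ.kerN w ^ i) v ∈ ρ.kerFil k := by
    intro i
    induction i with
    | zero => exact hv
    | succ i ih =>
      rw [pow_succ', Module.End.mul_apply]
      exact ρ.kerFil_le_comap k w ih
  rw [aeval_eq_sum_range, LinearMap.sum_apply]
  exact Submodule.sum_mem _ fun i _ => Submodule.smul_mem _ _ (hpow i)

variable [FiniteDimensional E V] [FiniteDimensional E V']

/-- Frobenius eigenvalues on `ρ_(j+1)` and `ρ'_(k+1)` have different weights for `j ≠ k`. -/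
theorem isCoprime_charpoly_primitivePart {ρ : WeilDeligneRep K E V} {ρ' : WeilDeligneRep K E V'}
    (hwm : ρ.IsWeightMonodromyCompatible) (hwm' : ρ'.IsWeightMonodromyCompatible)
    {w : weilGroup K} (hw : IsFrob (w : AbsGal K)) {j k : ℕ} (hjk : j ≠ k) :
    IsCoprime (ρ.primitivePart (j + 1) w).charpoly (ρ'.primitivePart (k + 1) w).charpoly := by
  refine (isCoprime_iff_aeval_ne_zero_of_isAlgClosed E (AlgebraicClosure E) _ _).2 fun α => ?_
  by_contra! h
  have h1 := (hwm (j + 1) (by omega) w hw α h.1).eq_abs (hwm' (k + 1) (by omega) w hw α h.2)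
  have hq : (1 : ℝ) < resCard K := by exact_mod_cast one_lt_resCard K
  have h2 := (Real.rpow_right_inj (by linarith) hq.ne').1 h1
  push_cast at h2
  exact hjk (by exact_mod_cast (by linarith : (j : ℝ) = k))

theorem aeval_charpoly_primitivePart_mem (ρ : WeilDeligneRep K E V) (k : ℕ) (w : weilGroup K)
    {v : LinearMap.ker ρ.N} (hv : v ∈ ρ.kerFil k) :
    aeval (ρ.kerN w) (ρ.primitivePart (k + 1) w).charpoly v ∈ ρ.kerFil (k + 1) :=
  aeval_charpoly_quotient_mem (ρ.kerN w) (ρ.kerFil_le_comap k w) _ (fun _ => rfl) hv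

/-- Because of the weights, a Frobenius-equivariant map `ker N → ker N'` respects the filtrations
by `im N ^ k`. -/
theorem map_mem_kerFil {ρ : WeilDeligneRep K E V} {ρ' : WeilDeligneRep K E V'}
    (hwm : ρ.IsWeightMonodromyCompatible) (hwm' : ρ'.IsWeightMonodromyCompatible)
    {w : weilGroup K} (hw : IsFrob (w : AbsGal K)) (f : LinearMap.ker ρ.N →ₗ[E] LinearMap.ker ρ'.N)
    (hf : ∀ v, f (ρ.kerN w v) = ρ'.kerN w (f v)) (k : ℕ) :
    ∀ v ∈ ρ.kerFil k, f v ∈ ρ'.kerFil k := by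
  have hfp : ∀ (p : E[X]) v, f (aeval (ρ.kerN w) p v) = aeval (ρ'.kerN w) p (f v) := by
    intro p v
    have hpow : ∀ i : ℕ, f ((ρ.kerN w ^ i) v) = (ρ'.kerN w ^ i) (f v) := by
      intro i
      induction i with
      | zero => rfl
      | succ i ih =>
        rw [pow_succ', Module.End.mul_apply, hf, ih, pow_succ', Module.End.mul_apply]
    simp only [aeval_eq_sum_range, LinearMap.sum_apply, LinearMap.smul_apply, map_sum, map_smul,
      hpow]
  -- by Cayley–Hamilton and coprimality the map `gr^j ker N → gr^k ker N'` vanishes for `k < j`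
  have step : ∀ j k, k < j → (∀ v ∈ ρ.kerFil j, f v ∈ ρ'.kerFil k) →
      (∀ v ∈ ρ.kerFil (j + 1), f v ∈ ρ'.kerFil (k + 1)) →
      ∀ v ∈ ρ.kerFil j, f v ∈ ρ'.kerFil (k + 1) := by
    intro j k hkj h1 h2 v hv
    obtain ⟨a, b, hab⟩ := isCoprime_charpoly_primitivePart hwm hwm' hw hkj.ne'
    have e1 : f v =
        aeval (ρ'.kerN w) a (f (aeval (ρ.kerN w) (ρ.primitivePart (j + 1) w).charpoly v)) +
        aeval (ρ'.kerN w) b (aeval (ρ'.kerN w) (ρ'.primitivePart (k + 1) w).charpoly (f v)) := by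
      rw [hfp, ← Module.End.mul_apply, ← Module.End.mul_apply, ← map_mul, ← map_mul,
        ← LinearMap.add_apply, ← map_add, hab, map_one, Module.End.one_apply]
    rw [e1]
    exact add_mem (ρ'.aeval_mem_kerFil _ w a (h2 _ (ρ.aeval_charpoly_primitivePart_mem j w hv)))
      (ρ'.aeval_mem_kerFil _ w b (ρ'.aeval_charpoly_primitivePart_mem k w (h1 v hv)))
  obtain ⟨n, hn⟩ := ρ.nilpotent
  have main : ∀ k j, k ≤ j → ∀ v ∈ ρ.kerFil j, f v ∈ ρ'.kerFil k := by
    intro k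
    induction k with
    | zero => exact fun j _ v _ => ⟨(f v).1, by simp⟩
    | succ k ih =>
      have h0 : ∀ j, n ≤ j → ∀ v ∈ ρ.kerFil j, f v ∈ ρ'.kerFil (k + 1) := by
        intro j hj v hv
        obtain ⟨z, hz⟩ := hv
        have hv0 : v = 0 := by
          refine Subtype.ext (hz.symm.trans ?_)
          rw [pow_eq_zero_of_le hj hn]
          rfl
        rw [hv0, map_zero]
        exact Submodule.zero_mem _
      have h1 : ∀ i j, n ≤ j + i → k < j → ∀ v ∈ ρ.kerFil j, f v ∈ ρ'.kerFil (k + 1) := by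
        intro i
        induction i with
        | zero => exact fun j hj _ => h0 j hj
        | succ i ihi =>
          exact fun j hj hkj => step j k hkj (ih j hkj.le) (ihi (j + 1) (by omega) (by omega))
      exact fun j hj => h1 n j (by omega) hj
  exact main k k le_rfl

end WeilDeligneRep

end Weights

/-! ### Weil–Deligne representations -/

namespace WeilDeligneRep

variable {K E V V' : Type*} [Field K] [ValuativeRel K] [Field E]
  [AddCommGroup V] [Module E V] [AddCommGroup V'] [Module E V']

/-- The image of inertia under a Weil–Deligne representation is finite. -/
theorem finite_image_inertia (ρ : WeilDeligneRep K E V) :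
    (ρ.weil '' ((inertiaGroup K).subgroupOf (weilGroup K) : Set (weilGroup K))).Finite := by
  obtain ⟨U, hU, hρ⟩ := ρ.smooth
  have : Finite (AbsGal K ⧸ U) := U.quotient_finite_of_isOpen hU
  have key : ∀ g ∈ (inertiaGroup K).subgroupOf (weilGroup K),
      ∀ h ∈ (inertiaGroup K).subgroupOf (weilGroup K),
      (QuotientGroup.mk (g : AbsGal K) : AbsGal K ⧸ U) = QuotientGroup.mk (h : AbsGal K) →
      ρ.weil g = ρ.weil h := by
    intro g hg h hh hgh
    have h1 : ρ.weil (g⁻¹ * h) = 1 :=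
      hρ _ (mul_mem (inv_mem hg) hh) (QuotientGroup.eq.1 hgh)
    rw [← mul_one (ρ.weil g), ← h1, ← map_mul, mul_inv_cancel_left]
  -- the image of `g` is determined by the coset of `g` modulo `U`, among finitely many
  refine Set.Finite.of_finite_image (f := fun T => {x : AbsGal K ⧸ U |
    ∃ g ∈ (inertiaGroup K).subgroupOf (weilGroup K), ρ.weil g = T ∧
      QuotientGroup.mk (g : AbsGal K) = x}) (Set.toFinite _) ?_
  rintro _ ⟨g, hg, rfl⟩ _ ⟨h, hh, rfl⟩ hgh
  have h1 : (QuotientGroup.mk (g : AbsGal K) : AbsGal K ⧸ U) ∈ {x : AbsGal K ⧸ U |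
    ∃ g' ∈ (inertiaGroup K).subgroupOf (weilGroup K), ρ.weil g' = ρ.weil g ∧
      QuotientGroup.mk (g' : AbsGal K) = x} := ⟨g, hg, rfl, rfl⟩
  dsimp only at hgh
  rw [hgh] at h1
  obtain ⟨g', hg', h2, h3⟩ := h1
  exact (key g' hg' g hg h3).symm.trans h2

variable [TopologicalSpace K] [IsNonarchimedeanLocalField K]

theorem normal_inertia : ((inertiaGroup K).subgroupOf (weilGroup K)).Normal := by
  refine ⟨fun t ht g => ?_⟩
  obtain ⟨d, hd⟩ := g.2
  have h := (hd.mul (hasFrobDegree_of_mem_inertiaGroup ht)).mul hd.inv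
  rw [add_zero, add_neg_cancel] at h
  exact h.mem_inertiaGroup

variable [CharZero E]

theorem hasInvariantProjections_weil [FiniteDimensional E V] {ρ : WeilDeligneRep K E V}
    (hss : ρ.IsFrobSemisimple) : HasInvariantProjections ρ.weil := by
  obtain ⟨φ, hφ⟩ := exists_isFrob K
  have := normal_inertia (K := K)
  refine hasInvariantProjections_of_finite ρ.weil ((inertiaGroup K).subgroupOf (weilGroup K))
    ⟨φ, 1, hφ.hasFrobDegree⟩ ρ.finite_image_inertia (hss _ hφ) fun g => ?_
  obtain ⟨d, hd⟩ := g.2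
  refine ⟨g * ⟨φ, 1, hφ.hasFrobDegree⟩ ^ (-d), ?_, d, by rw [mul_assoc, ← zpow_add]; simp⟩
  have h := hd.mul (hφ.hasFrobDegree.zpow (-d))
  rw [mul_one, add_neg_cancel] at h
  exact h.mem_inertiaGroup

theorem hasInvariantProjections_kerN {ρ : WeilDeligneRep K E V}
    (h : HasInvariantProjections ρ.weil) : HasInvariantProjections ρ.kerN := by
  intro p hp
  obtain ⟨e, he, hmem, hid⟩ := h (p.map (LinearMap.ker ρ.N).subtype) (by
    rintro g _ ⟨v, hv, rfl⟩
    exact ⟨ρ.kerN g v, hp g hv, rfl⟩)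
  have hmem' : ∀ v, ∃ h : e v ∈ LinearMap.ker ρ.N, (⟨e v, h⟩ : LinearMap.ker ρ.N) ∈ p := by
    intro v
    obtain ⟨y, hy, hyv⟩ := hmem v
    rw [← hyv]
    exact ⟨y.2, hy⟩
  refine ⟨e.restrict (p := LinearMap.ker ρ.N) (q := LinearMap.ker ρ.N) fun v _ => (hmem' v).1,
    fun g => ?_, fun v => (hmem' v).2, fun v hv => Subtype.ext (hid v ⟨v, hv, rfl⟩)⟩
  exact LinearMap.ext fun v => Subtype.ext (LinearMap.congr_fun (he g).eq v.1)

/-- Traces on the Frobenius elements of finite extensions determine the traces on the whole Weil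
group. -/
theorem trace_kerN_eq [FiniteDimensional E V] [FiniteDimensional E V']
    {ρ : WeilDeligneRep K E V} {ρ' : WeilDeligneRep K E V'}
    (htr : ∀ L : IntermediateField K (SeparableClosure K), FiniteDimensional K L →
      ρ.IsUnramifiedOver L → ρ'.IsUnramifiedOver L →
      ∀ w : weilGroup K, IsFrobOver L (w : AbsGal K) →
        LinearMap.trace E _ (ρ.kerN w) = LinearMap.trace E _ (ρ'.kerN w)) (w : weilGroup K) :
    LinearMap.trace E _ (ρ.kerN w) = LinearMap.trace E _ (ρ'.kerN w) := by
  obtain ⟨U, hU, hρ⟩ := ρ.smooth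
  obtain ⟨U', hU', hρ'⟩ := ρ'.smooth
  have hpos : ∀ (w : weilGroup K) (d : ℕ), d ≠ 0 → HasFrobDegree (w : AbsGal K) d →
      LinearMap.trace E _ (ρ.kerN w) = LinearMap.trace E _ (ρ'.kerN w) := by
    intro w d hd hw
    obtain ⟨L, hLfin, hL, hLU⟩ := exists_isFrobOver (U := U ⊓ U') hd hw.actsAsPow (hU.inter hU')
    exact htr L hLfin (fun σ hσ hσL => hρ σ hσ (hLU _ hσ hσL).1)
      (fun σ hσ hσL => hρ' σ hσ (hLU _ hσ hσL).2) w hL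
  obtain ⟨φ, hφ⟩ := exists_isFrob K
  obtain ⟨d, hd⟩ := w.2
  let Φ : weilGroup K := ⟨φ, 1, hφ.hasFrobDegree⟩
  refine trace_eq_of_eventually_trace_mul_pow_eq (φ := ρ.kerN Φ) (φ' := ρ'.kerN Φ)
    ((Group.isUnit Φ).map ρ.kerN) ((Group.isUnit Φ).map ρ'.kerN) (d.natAbs + 1) fun k hk => ?_
  rw [← map_pow, ← map_pow, ← map_mul, ← map_mul]
  refine hpos _ (d + k).toNat (by omega) ?_
  have h1 := hd.mul (hφ.hasFrobDegree.pow k)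
  rw [mul_one] at h1
  rw [Int.toNat_of_nonneg (by omega)]
  exact h1

/-- Injective morphisms of Weil–Deligne representations exist as soon as the kernels of the
monodromy operators are isomorphic: by the weights, the isomorphism respects the filtrations. -/
theorem exists_injective_of_kerN_equiv [FiniteDimensional E V] [FiniteDimensional E V']
    {ρ : WeilDeligneRep K E V} {ρ' : WeilDeligneRep K E V'}
    (hss : ρ.IsFrobSemisimple) (hss' : ρ'.IsFrobSemisimple)
    (hwm : ρ.IsWeightMonodromyCompatible) (hwm' : ρ'.IsWeightMonodromyCompatible)
    (e : LinearMap.ker ρ.N ≃ₗ[E] LinearMap.ker ρ'.N)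
    (he : ∀ w v, e (ρ.kerN w v) = ρ'.kerN w (e v)) :
    ∃ h : V →ₗ[E] V', Function.Injective h ∧ (∀ w v, h (ρ.weil w v) = ρ'.weil w (h v)) ∧
      ∀ v, h (ρ.N v) = ρ'.N (h v) := by
  obtain ⟨φ, hφ⟩ := exists_isFrob K
  have hfil := map_mem_kerFil hwm hwm' (w := ⟨φ, 1, hφ.hasFrobDegree⟩) hφ e.toLinearMap (he _)
  obtain ⟨f, hf⟩ := ((LinearMap.ker ρ'.N).subtype ∘ₗ e.toLinearMap).exists_extend
  have hf' : ∀ v (hv : ρ.N v = 0), f v = e ⟨v, hv⟩ := fun v hv => LinearMap.congr_fun hf ⟨v, hv⟩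
  choose d hd using fun w : weilGroup K => w.2
  have hq : (resCard K : E) ≠ 0 := Nat.cast_ne_zero.2 (one_lt_resCard K).ne_bot
  refine exists_extension (c := fun w => (resCard K : E) ^ d w)
    (hasInvariantProjections_weil hss) (hasInvariantProjections_weil hss')
    (fun w => zpow_ne_zero _ hq) (fun w v => LinearMap.congr_fun (ρ.weil_N w _ (hd w)) v)
    (fun w v => LinearMap.congr_fun (ρ'.weil_N w _ (hd w)) v) ρ.nilpotent f ?_ ?_ ?_ ?_
  · intro w v hv
    rw [hf' v hv, hf' _ (ρ.ker_N_le_comap w hv)]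
    exact congrArg Subtype.val (he w ⟨v, hv⟩)
  · intro v hv
    rw [hf' v hv]
    exact (e ⟨v, hv⟩).2
  · intro k v hv hv0
    rw [hf' v hv0]
    exact hfil k ⟨v, hv0⟩ hv
  · intro v hv hfv
    rw [hf' v hv] at hfv
    have h1 : e ⟨v, hv⟩ = 0 := Subtype.ext hfv
    exact congrArg Subtype.val (e.map_eq_zero_iff.1 h1)

end WeilDeligneRep

theorem corollary5 {K : Type*} [Field K] [ValuativeRel K] [TopologicalSpace K]
    [IsNonarchimedeanLocalField K]
    {E : Type*} [Field E] [CharZero E]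
    {V : Type*} [AddCommGroup V] [Module E V] [FiniteDimensional E V]
    {V' : Type*} [AddCommGroup V'] [Module E V'] [FiniteDimensional E V']
    (ρ : WeilDeligneRep K E V) (ρ' : WeilDeligneRep K E V')
    (hss : ρ.IsFrobSemisimple) (hss' : ρ'.IsFrobSemisimple)
    (hwm : ρ.IsWeightMonodromyCompatible) (hwm' : ρ'.IsWeightMonodromyCompatible)
    (htr : ∀ L : IntermediateField K (SeparableClosure K), FiniteDimensional K L →
      ρ.IsUnramifiedOver L → ρ'.IsUnramifiedOver L →
      ∀ w : weilGroup K, IsFrobOver L (w : AbsGal K) →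
        LinearMap.trace E _ (ρ.kerN w) = LinearMap.trace E _ (ρ'.kerN w)) :
    ρ.IsIsomorphic ρ' := by
  obtain ⟨e, he⟩ := exists_equiv_of_trace_eq
    (WeilDeligneRep.hasInvariantProjections_kerN (WeilDeligneRep.hasInvariantProjections_weil hss))
    (WeilDeligneRep.hasInvariantProjections_kerN (WeilDeligneRep.hasInvariantProjections_weil hss'))
    (WeilDeligneRep.trace_kerN_eq htr)
  obtain ⟨h, hinj, hh, hN⟩ :=
    WeilDeligneRep.exists_injective_of_kerN_equiv hss hss' hwm hwm' e he
  -- the same argument for the inverse shows that the dimensions agree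
  obtain ⟨h', hinj', -⟩ :=
    WeilDeligneRep.exists_injective_of_kerN_equiv hss' hss hwm' hwm e.symm fun w v => by
      rw [LinearEquiv.symm_apply_eq, he, LinearEquiv.apply_symm_apply]
  have hdim : Module.finrank E V = Module.finrank E V' :=
    le_antisymm (LinearMap.finrank_le_finrank_of_injective hinj)
      (LinearMap.finrank_le_finrank_of_injective hinj')
  exact ⟨.mk (LinearEquiv.ofInjectiveOfFinrankEq h hinj hdim) fun w => LinearMap.ext (hh w), hN⟩
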